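/- Let $d \ge 3$ be fixed. For $N \ge 1$ let $\mathcal{S}^d(N)$ be the space of symmetric real tensors $W = (W_{i_1 \dots i_d})_{1 \le i_1,\dots,i_d \le N}$, i.e. those whose entries are invariant under every permutation of the indices, with the Frobenius norm $\|W\|_F^2 = \sum_{i_1,\dots,i_d} W_{i_1 \dots i_d}^2$. On one probability space let $\mathbf{W}_N$, $N \ge 1$, be random tensors with arbitrary joint distribution such that $\mathbf{W}_N \in \mathcal{S}^d(N)$ has density $$f(W) = \frac{1}{Z_d(N)} e^{-\frac12 \|W\|_F^2}$$ with respect to the Lebesgue measure on $\mathcal{S}^d(N)$, where $Z_d(N)$ is the normalization constant. For a vector $v \in \mathbb{R}^N$ let $\mathbf{W}_N \cdot v^{d-2}$ be the symmetric $N \times N$ matrix with entries $$(\mathbf{W}_N \cdot v^{d-2})_{ij} = \sum_{a_1,\dots,a_{d-2}=1}^N (\mathbf{W}_N)_{a_1 \dots a_{d-2}\, i\, j}\, v_{a_1} \cdots v_{a_{d-2}}.$$ Put $\beta_d = 2/\sqrt{d(d-1)}$. Then for every deterministic sequence of unit vectors $v_N \in \mathbb{R}^N$, almost surely, as $N \to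 \infty$, the empirical spectral measure $\frac1N \sum_{i=1}^N \delta_{\mu_i}$, where $\mu_1, \dots, \mu_N$ are the eigenvalues of $\frac{1}{\sqrt N} \mathbf{W}_N \cdot v_N^{d-2}$, converges weakly to the semicircle law $$\rho(dx) = \frac{2}{\pi \beta_d^2} \sqrt{(\beta_d^2 - x^2)^+}\, dx.$$ This $\rho$ is a probability measure with support $[-\beta_d, \beta_d]$, and its Stieltjes transform is $$\int_{\mathbb{R}} \frac{1}{t - z}\, \rho(dt) = m_d(z) = \frac{2}{\beta_d^2}\left( -z + z \sqrt{1 - \frac{\beta_d^2}{z^2}} \right), \qquad z \in \mathbb{C} \setminus [-\beta_d, \beta_d],$$ with the principal branch of the square root. -/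

import Mathlib

open MeasureTheory ProbabilityTheory Filter Topology
open scoped ENNReal BoundedContinuousFunction

noncomputable section

/-- The space of symmetric real tensors of order `d` and dimensions `N × ⋯ × N`, as a subspace of
all arrays indexed by `Fin d → Fin N`. The norm inherited from `EuclideanSpace` is the Frobenius
norm, i.e. the square root of the sum of the squares of all `N ^ d` entries. -/
def SymTensor (d N : ℕ) : Submodule ℝ (EuclideanSpace ℝ (Fin d → Fin N)) where
  carrier := {T | ∀ (σ : Equiv.Perm (Fin d)) (i : Fin d → Fin N), T (i ∘ σ) = T i}
  add_mem' := by
    intro S T hS hT σ i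
    simp [hS σ i, hT σ i]
  zero_mem' := by
    intro σ i
    simp
  smul_mem' := by
    intro c T hT σ i
    simp [hT σ i]

/-- Lebesgue measure on the Euclidean space of symmetric tensors (in which the unit cube of any
orthonormal basis has measure one). -/
def symTensorVolume (d N : ℕ) : Measure (SymTensor d N) :=
  (stdOrthonormalBasis ℝ (SymTensor d N)).toBasis.addHaar

/-- The normalization constant `Z_d(N)` of the Gaussian orthogonal tensor ensemble. -/
def gaussianTensorZ (d N : ℕ) : ℝ :=
  ∫ T : SymTensor d N, Real.exp (-(1 / 2) * ‖T‖ ^ 2) ∂(symTensorVolume d N)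

/-- The Gaussian orthogonal tensor ensemble: the law on symmetric tensors with density
`exp (-‖T‖_F ^ 2 / 2) / Z_d(N)`. -/
def gaussianTensorLaw (d N : ℕ) : Measure (SymTensor d N) :=
  (symTensorVolume d N).withDensity fun T =>
    ENNReal.ofReal (1 / gaussianTensorZ d N * Real.exp (-(1 / 2) * ‖T‖ ^ 2))

/-- The multi-index `(a₁, …, a_{d-2}, i, j)`. -/
def contractIndex {d N : ℕ} (a : Fin (d - 2) → Fin N) (i j : Fin N) : Fin d → Fin N :=
  fun k => if h : (k : ℕ) < d - 2 then a ⟨k, h⟩ else if (k : ℕ) = d - 2 then i else j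

/-- The contraction `T · v^{d-2}`, an `N × N` matrix:
`(T · v^{d-2})_{ij} = ∑_{a₁, …, a_{d-2}} T_{a₁ … a_{d-2} i j} v_{a₁} ⋯ v_{a_{d-2}}`. -/
def contractMatrix {d N : ℕ} (T : SymTensor d N) (v : EuclideanSpace ℝ (Fin N)) :
    Matrix (Fin N) (Fin N) ℝ :=
  Matrix.of fun i j =>
    ∑ a : Fin (d - 2) → Fin N,
      (T : EuclideanSpace ℝ (Fin d → Fin N)) (contractIndex a i j) * ∏ k, v (a k)

/-- The matrix `(1 / √N) T · v^{d-2}`. -/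
def scaledContraction {d N : ℕ} (T : SymTensor d N) (v : EuclideanSpace ℝ (Fin N)) :
    Matrix (Fin N) (Fin N) ℝ :=
  (1 / Real.sqrt N) • contractMatrix T v

theorem contractMatrix_isHermitian {d N : ℕ} (hd : 2 ≤ d) (T : SymTensor d N)
    (v : EuclideanSpace ℝ (Fin N)) : (contractMatrix T v).IsHermitian := by
  ext i j
  simp only [contractMatrix, Matrix.conjTranspose_apply, Matrix.of_apply, star_trivial]
  refine Finset.sum_congr rfl fun a _ => ?_
  congr 1
  rw [← T.2 (Equiv.swap ⟨d - 2, by omega⟩ ⟨d - 1, by omega⟩) (contractIndex a i j)]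
  refine congrArg (T : EuclideanSpace ℝ (Fin d → Fin N)).ofLp ?_
  funext k
  simp only [contractIndex, Function.comp_apply, Equiv.swap_apply_def, Fin.ext_iff]
  have hk := k.2
  have h1 : ¬ (d - 1 < d - 2) := by omega
  have h2 : ¬ (d - 1 = d - 2) := by omega
  by_cases hk2 : (k : ℕ) = d - 2
  · simp [hk2, h1, h2]
  · by_cases hk1 : (k : ℕ) = d - 1
    · simp [hk1, h1, h2]
    · have h3 : (k : ℕ) < d - 2 := by omega
      simp [hk2, hk1, h3]

theorem scaledContraction_isHermitian {d N : ℕ} (hd : 2 ≤ d) (T : SymTensor d N)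
    (v : EuclideanSpace ℝ (Fin N)) : (scaledContraction T v).IsHermitian := by
  have h := contractMatrix_isHermitian hd T v
  unfold Matrix.IsHermitian at h ⊢
  rw [scaledContraction, Matrix.conjTranspose_smul, h, star_trivial]

/-- The empirical spectral measure `(1 / N) ∑ᵢ δ_{μᵢ(A)}` of a symmetric `N × N` matrix `A`, its
eigenvalues being counted with multiplicity. -/
def empiricalSpectralMeasure {N : ℕ} {A : Matrix (Fin N) (Fin N) ℝ} (hA : A.IsHermitian) :
    Measure ℝ :=
  (N : ℝ≥0∞)⁻¹ • ∑ i, Measure.dirac (hA.eigenvalues i)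

/-- The edge `β_d = 2 / √(d (d - 1))` of the limiting spectrum. -/
def betaEdge (d : ℕ) : ℝ := 2 / Real.sqrt ((d : ℝ) * ((d : ℝ) - 1))

/-- The semicircle law on `[-β, β]`, with density `2 / (π β²) √((β² - x²)⁺)`. -/
def semicircleLaw (β : ℝ) : Measure ℝ :=
  volume.withDensity fun x =>
    ENNReal.ofReal (2 / (Real.pi * β ^ 2) * Real.sqrt (max (β ^ 2 - x ^ 2) 0))

/-- `m_d(z) = (2 / β_d²) (-z + z √(1 - β_d² / z²))`, with the principal square root. -/
def stieltjesM (d : ℕ) (z : ℂ) : ℂ :=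
  2 / (betaEdge d : ℂ) ^ 2 * (-z + z * Complex.sqrt (1 - (betaEdge d : ℂ) ^ 2 / z ^ 2))

/-- Weak convergence of a sequence of measures on `ℝ`, tested on bounded continuous functions. -/
def ConvergesWeakly (ρ : ℕ → Measure ℝ) (ρ' : Measure ℝ) : Prop :=
  ∀ f : ℝ →ᵇ ℝ, Tendsto (fun N => ∫ x, f x ∂(ρ N)) atTop (𝓝 (∫ x, f x ∂ρ'))

end

/-!
For a fixed unit vector `v` the matrix `T · v^{d-2}` is, up to a perturbation in the direction `v`,
a real symmetric Gaussian matrix whose off-diagonal entries have variance `s = 1 / (d (d - 1))`, so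
a semicircle law with edge `2 √s = β_d` is to be expected. The argument works with the Stieltjes
transform `m_N(z) = (1 / N) tr (X - z)⁻¹` of `X = N^{-1/2} T · v^{d-2}` and shows directly that the
defect `Q_N = s m_N² + z m_N + 1` has second moment `O(1 / N²)`. The sum over `N` of these moments
is finite, so `Q_N → 0` almost surely whatever the joint law of the tensors, and no concentration
inequality or independence is needed.

The moment bound (`integral_norm_semicircleDefect_sq_le`) comes from Stein's identity
`E[⟨T, h⟩ f(T)] = E[∂_h f(T)]` for the Gaussian law
(`integral_inner_mul_eq_integral_lineDeriv`). An entry of `T · v^{d-2}` is, up to a factor, the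
inner product of `T` with an explicit symmetric tensor (`slotTensor`, `inner_slotTensor`), whose own
contraction with `v` is computed in `contractMatrix_slotTensor`. Writing `1 + z m_N` as
`(1 / N) tr (X (X - z)⁻¹)` and integrating by parts in
`E[Q_N conj Q_N] = E[s m_N² conj Q_N] + E[(1 / N) tr (X (X - z)⁻¹) conj Q_N]`, the second term
produces `-E[s m_N² conj Q_N]`, an error of size `O(1 / N) E|Q_N|`, and the contribution of the
derivative of `conj Q_N`, which is `O(1 / N²)` since `m_N` has gradient of order `1 / N`
(`sum_steinDerivative`, `norm_error_le`). Absorbing the linear term gives `E|Q_N|² = O(1 / N²)`.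

For `Im z > 0` the quadratic `s m² + z m + 1` has only one root in the closed upper half-plane, and
this root is stable (`norm_sub_mul_im_le_norm_semicircleDefect`). The Stieltjes transform of the
semicircle law is that root: its closed form follows from the substitution `t = β cos θ` and the
expansion of `sin² θ / (1 - 2 w cos θ + w²)` in powers of `w`, where `z = (β / 2) (w + 1 / w)` and
`|w| < 1` (`integral_one_div_sub_semicircleLaw`). Hence, almost surely, `m_N(z)` converges to the
Stieltjes transform of the semicircle law for all `z` in a countable dense subset of the upper
half-plane. Since the functions `1 / (t - z)` and the constants span a space whose closure is a star
algebra separating points, and since convergence of Stieltjes transforms implies tightness, this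
gives weak convergence (`tendsto_integral_of_tendsto_stieltjes`).
-/

/-! ### The semicircle law -/

lemma betaEdge_pos {d : ℕ} (hd : 2 ≤ d) : 0 < betaEdge d := by
  have h : (2 : ℝ) ≤ d := by exact_mod_cast hd
  unfold betaEdge
  have : 0 < (d : ℝ) * ((d : ℝ) - 1) := by nlinarith
  positivity

lemma betaEdge_sq {d : ℕ} (hd : 2 ≤ d) :
    betaEdge d ^ 2 = 4 / ((d : ℝ) * ((d : ℝ) - 1)) := by
  have h : (2 : ℝ) ≤ d := by exact_mod_cast hd
  have : 0 ≤ (d : ℝ) * ((d : ℝ) - 1) := by nlinarith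
  rw [betaEdge, div_pow, Real.sq_sqrt this]
  norm_num

lemma continuous_semicircleDensity (β : ℝ) :
    Continuous fun x : ℝ => 2 / (Real.pi * β ^ 2) * Real.sqrt (max (β ^ 2 - x ^ 2) 0) := by
  fun_prop

/-- The substitution `t = β cos θ`. -/
lemma integral_sqrt_smul {E : Type*} [NormedAddCommGroup E] [NormedSpace ℝ E] {β : ℝ}
    (hβ : 0 < β) {f : ℝ → E} (hf : ContinuousOn f (Set.Icc (-β) β)) :
    ∫ t in -β..β, Real.sqrt (max (β ^ 2 - t ^ 2) 0) • f t =
      β ^ 2 • ∫ θ in (0 : ℝ)..Real.pi, Real.sin θ ^ 2 • f (β * Real.cos θ) := by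
  have hsub := intervalIntegral.integral_deriv_smul_comp'' (a := 0) (b := Real.pi)
    (f := fun θ => β * Real.cos θ) (f' := fun θ => β * (-Real.sin θ))
    (g := fun t => Real.sqrt (max (β ^ 2 - t ^ 2) 0) • f t) (by fun_prop)
    (fun θ _ => ((Real.hasDerivAt_cos θ).const_mul β).hasDerivWithinAt) (by fun_prop) (by
      refine ContinuousOn.smul (by fun_prop) (hf.mono ?_)
      rintro _ ⟨θ, -, rfl⟩
      constructor <;> nlinarith [Real.neg_one_le_cos θ, Real.cos_le_one θ])
  simp only [Real.cos_zero, Real.cos_pi, mul_one, mul_neg] at hsub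
  rw [intervalIntegral.integral_symm, ← hsub, ← intervalIntegral.integral_neg,
    ← intervalIntegral.integral_smul]
  refine intervalIntegral.integral_congr fun θ hθ => ?_
  rw [Set.uIcc_of_le Real.pi_pos.le] at hθ
  have hs : 0 ≤ Real.sin θ := Real.sin_nonneg_of_mem_Icc hθ
  have h1 : β ^ 2 - (β * Real.cos θ) ^ 2 = (β * Real.sin θ) ^ 2 := by
    nlinarith [Real.sin_sq_add_cos_sq θ]
  simp only [Function.comp_apply, h1]
  rw [max_eq_left (sq_nonneg _), Real.sqrt_sq (by positivity), smul_smul, smul_smul,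
    ← neg_smul]
  congr 1
  ring

lemma semicircleDensity_eq_zero {β x : ℝ} (hβ : 0 < β) (hx : x ∉ Set.Ioc (-β) β) :
    Real.sqrt (max (β ^ 2 - x ^ 2) 0) = 0 := by
  rw [Real.sqrt_eq_zero', max_le_iff]
  refine ⟨?_, le_rfl⟩
  rw [Set.mem_Ioc, not_and_or, not_lt, not_le] at hx
  rcases hx with h | h <;> nlinarith

lemma integral_semicircleLaw {E : Type*} [NormedAddCommGroup E] [NormedSpace ℝ E]
    {β : ℝ} (hβ : 0 < β) {f : ℝ → E} (hf : ContinuousOn f (Set.Icc (-β) β)) :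
    ∫ t, f t ∂(semicircleLaw β) =
      (2 / Real.pi) • ∫ θ in (0 : ℝ)..Real.pi, Real.sin θ ^ 2 • f (β * Real.cos θ) := by
  have h0 : ∀ x : ℝ, 0 ≤ 2 / (Real.pi * β ^ 2) * Real.sqrt (max (β ^ 2 - x ^ 2) 0) := by
    intro x
    have := Real.pi_pos
    positivity
  rw [semicircleLaw, integral_withDensity_eq_integral_toReal_smul
    (continuous_semicircleDensity β).measurable.ennreal_ofReal
    (Eventually.of_forall fun x => ENNReal.ofReal_lt_top)]
  simp only [ENNReal.toReal_ofReal (h0 _), mul_smul]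
  rw [integral_smul, ← setIntegral_eq_integral_of_forall_compl_eq_zero (s := Set.Ioc (-β) β),
    ← intervalIntegral.integral_of_le (by linarith), integral_sqrt_smul hβ hf, smul_smul]
  · congr 1
    field_simp
  · intro x hx
    rw [semicircleDensity_eq_zero hβ hx, zero_smul]

lemma integral_sin_sq_zero_pi : ∫ θ in (0 : ℝ)..Real.pi, Real.sin θ ^ 2 = Real.pi / 2 := by
  rw [integral_sin_sq]
  simp

lemma isProbabilityMeasure_semicircleLaw {β : ℝ} (hβ : 0 < β) :
    IsProbabilityMeasure (semicircleLaw β) := by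
  have h0 : ∀ x : ℝ, 0 ≤ 2 / (Real.pi * β ^ 2) * Real.sqrt (max (β ^ 2 - x ^ 2) 0) := by
    intro x
    have := Real.pi_pos
    positivity
  have hsupp : HasCompactSupport
      fun x : ℝ => 2 / (Real.pi * β ^ 2) * Real.sqrt (max (β ^ 2 - x ^ 2) 0) := by
    refine HasCompactSupport.intro (isCompact_Icc (a := -β) (b := β)) fun x hx => ?_
    rw [semicircleDensity_eq_zero hβ fun h => hx (Set.Ioc_subset_Icc_self h), mul_zero]
  have hint := (continuous_semicircleDensity β).integrable_of_hasCompactSupport (μ := volume) hsupp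
  have hfin : IsFiniteMeasure (semicircleLaw β) := by
    refine ⟨?_⟩
    rw [semicircleLaw, withDensity_apply _ MeasurableSet.univ, Measure.restrict_univ,
      ← ofReal_integral_eq_lintegral_ofReal hint (Eventually.of_forall h0)]
    exact ENNReal.ofReal_lt_top
  have h1 := integral_semicircleLaw hβ (f := fun _ => (1 : ℝ)) continuousOn_const
  simp only [smul_eq_mul, mul_one, integral_sin_sq_zero_pi, integral_const] at h1
  have h2 : (semicircleLaw β).real Set.univ = 1 := by
    rw [h1]
    field_simp
  refine ⟨?_⟩
  rw [Measure.real, ENNReal.toReal_eq_one_iff] at h2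
  exact h2

lemma support_semicircleLaw {β : ℝ} (hβ : 0 < β) :
    (semicircleLaw β).support = Set.Icc (-β) β := by
  have hm : Measurable fun x : ℝ =>
      ENNReal.ofReal (2 / (Real.pi * β ^ 2) * Real.sqrt (max (β ^ 2 - x ^ 2) 0)) :=
    (continuous_semicircleDensity β).measurable.ennreal_ofReal
  have hpos : ∀ x : ℝ, x ∈ Set.Ioo (-β) β →
      0 < 2 / (Real.pi * β ^ 2) * Real.sqrt (max (β ^ 2 - x ^ 2) 0) := by
    intro x hx
    have h1 : 0 < β ^ 2 - x ^ 2 := by nlinarith [hx.1, hx.2]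
    have h2 : 0 < Real.sqrt (max (β ^ 2 - x ^ 2) 0) := Real.sqrt_pos.2 (lt_max_of_lt_left h1)
    have := Real.pi_pos
    positivity
  apply Set.Subset.antisymm
  · refine Measure.support_subset_of_isClosed isClosed_Icc ?_
    rw [mem_ae_iff, semicircleLaw, withDensity_apply _ measurableSet_Icc.compl]
    refine setLIntegral_eq_zero measurableSet_Icc.compl fun x hx => ?_
    rw [semicircleDensity_eq_zero hβ fun h => hx (Set.Ioc_subset_Icc_self h)]
    simp
  · have h1 : Set.Ioo (-β) β ⊆ (semicircleLaw β).support := by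
      intro x hx
      rw [Measure.mem_support_iff_forall]
      intro U hU
      have hU' : U ∩ Set.Ioo (-β) β ∈ 𝓝 x := inter_mem hU (Ioo_mem_nhds hx.1 hx.2)
      obtain ⟨V, hVU, hVo, hxV⟩ := mem_nhds_iff.1 hU'
      refine lt_of_lt_of_le ?_ (measure_mono (hVU.trans Set.inter_subset_left))
      rw [pos_iff_ne_zero, semicircleLaw, Ne, withDensity_apply_eq_zero hm]
      have h2 : {x : ℝ | ENNReal.ofReal (2 / (Real.pi * β ^ 2) *
          Real.sqrt (max (β ^ 2 - x ^ 2) 0)) ≠ 0} ∩ V = V := by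
        rw [Set.inter_eq_right]
        intro y hy
        simp only [Set.mem_ofPred_eq, ne_eq, ENNReal.ofReal_eq_zero, not_le]
        exact hpos y (hVU hy).2
      rw [h2]
      exact (hVo.measure_pos volume ⟨x, hxV⟩).ne'
    rw [← closure_Ioo (by linarith : -β ≠ β)]
    exact closure_minimal h1 Measure.isClosed_support

lemma hasSum_pow_mul_sin_mul_sin {w : ℂ} (hw : ‖w‖ < 1) (θ : ℝ) :
    HasSum (fun k : ℕ => w ^ k * ((Real.sin ((k + 1) * θ) * Real.sin θ : ℝ) : ℂ))
      ((Real.sin θ : ℂ) ^ 2 / (1 - 2 * w * Real.cos θ + w ^ 2)) := by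
  set e := Complex.exp (θ * Complex.I) with he
  set e' := Complex.exp (-θ * Complex.I) with he'
  have hee : e * e' = 1 := by
    rw [he, he', ← Complex.exp_add]
    simp
  have hne : ‖e‖ = 1 := Complex.norm_exp_ofReal_mul_I θ
  have hne' : ‖e'‖ = 1 := by
    rw [he']
    exact_mod_cast Complex.norm_exp_ofReal_mul_I (-θ)
  have hsin : (Real.sin θ : ℂ) = (e' - e) * Complex.I / 2 := by
    rw [Complex.ofReal_sin]; rfl
  have hcos : (Real.cos θ : ℂ) = (e + e') / 2 := by
    rw [Complex.ofReal_cos]; rfl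
  have h1 : ‖w * e‖ < 1 := by rwa [norm_mul, hne, mul_one]
  have h2 : ‖w * e'‖ < 1 := by rwa [norm_mul, hne', mul_one]
  have hd1 : 1 - w * e ≠ 0 := by
    intro h
    rw [← sub_eq_zero.1 h] at h1
    simp at h1
  have hd2 : 1 - w * e' ≠ 0 := by
    intro h
    rw [← sub_eq_zero.1 h] at h2
    simp at h2
  have hden : 1 - 2 * w * Real.cos θ + w ^ 2 = (1 - w * e) * (1 - w * e') := by
    rw [hcos]
    linear_combination (-w ^ 2) * hee
  have hs := (((hasSum_geometric_of_norm_lt_one h2).mul_left e').sub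
    ((hasSum_geometric_of_norm_lt_one h1).mul_left e)).mul_right
      (Complex.I / 2 * (Real.sin θ : ℂ))
  have hterm : (fun k : ℕ => w ^ k * ((Real.sin ((k + 1) * θ) * Real.sin θ : ℝ) : ℂ)) =
      fun k => (e' * (w * e') ^ k - e * (w * e) ^ k) * (Complex.I / 2 * (Real.sin θ : ℂ)) := by
    funext k
    have hk : ((Real.sin ((k + 1) * θ) : ℝ) : ℂ) =
        (e' ^ (k + 1) - e ^ (k + 1)) * Complex.I / 2 := by
      have e1 : -(((k : ℂ) + 1) * θ) * Complex.I = ((k + 1 : ℕ) : ℂ) * (-θ * Complex.I) := by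
        push_cast; ring
      have e2 : (((k : ℂ) + 1) * θ) * Complex.I = ((k + 1 : ℕ) : ℂ) * (θ * Complex.I) := by
        push_cast; ring
      rw [Complex.ofReal_sin, Complex.sin, he, he', ← Complex.exp_nat_mul, ← Complex.exp_nat_mul,
        ← e1, ← e2]
      push_cast
      rfl
    rw [Complex.ofReal_mul, hk]
    ring
  have hval : (Real.sin θ : ℂ) ^ 2 / (1 - 2 * w * Real.cos θ + w ^ 2) =
      (e' * (1 - w * e')⁻¹ - e * (1 - w * e)⁻¹) * (Complex.I / 2 * (Real.sin θ : ℂ)) := by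
    have hfrac : e' * (1 - w * e')⁻¹ - e * (1 - w * e)⁻¹ =
        (e' - e) / ((1 - w * e) * (1 - w * e')) := by
      rw [eq_div_iff (mul_ne_zero hd1 hd2)]
      calc _ = e' * ((1 - w * e')⁻¹ * (1 - w * e')) * (1 - w * e) -
            e * ((1 - w * e)⁻¹ * (1 - w * e)) * (1 - w * e') := by ring
        _ = e' - e := by rw [inv_mul_cancel₀ hd1, inv_mul_cancel₀ hd2]; ring
    rw [hden, hfrac, hsin]
    ring
  rw [hterm, hval]
  exact hs

lemma integral_sin_succ_mul_sin (k : ℕ) :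
    ∫ θ in (0 : ℝ)..Real.pi, Real.sin ((k + 1) * θ) * Real.sin θ =
      if k = 0 then Real.pi / 2 else 0 := by
  split_ifs with hk
  · subst hk
    simp [← pow_two]
  · have hcos : ∀ j : ℕ, j ≠ 0 → ∫ θ in (0 : ℝ)..Real.pi, Real.cos (j * θ) = 0 := by
      intro j hj
      rw [intervalIntegral.integral_comp_mul_left _ (by exact_mod_cast hj)]
      simp [Real.sin_nat_mul_pi]
    have h : ∀ θ : ℝ, Real.sin ((k + 1) * θ) * Real.sin θ =
        (1 / 2) * (Real.cos ((k : ℕ) * θ) - Real.cos ((k + 2 : ℕ) * θ)) := by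
      intro θ
      have e1 : ((k : ℕ) : ℝ) * θ = (k + 1) * θ - θ := by ring
      have e2 : ((k + 2 : ℕ) : ℝ) * θ = (k + 1) * θ + θ := by push_cast; ring
      rw [e1, e2, Real.cos_sub, Real.cos_add]
      ring
    simp only [h]
    rw [intervalIntegral.integral_const_mul, intervalIntegral.integral_sub
      (Continuous.intervalIntegrable (by fun_prop) _ _)
      (Continuous.intervalIntegrable (by fun_prop) _ _), hcos k hk, hcos (k + 2) (by omega)]
    simp

/-- Only the constant term of the expansion
`sin² θ / (1 - 2 w cos θ + w²) = ∑ₖ wᵏ sin ((k + 1) θ) sin θ` contributes to the integral. -/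
lemma integral_sin_sq_div {w : ℂ} (hw : ‖w‖ < 1) :
    ∫ θ in (0 : ℝ)..Real.pi, (Real.sin θ : ℂ) ^ 2 / (1 - 2 * w * Real.cos θ + w ^ 2) =
      (Real.pi / 2 : ℂ) := by
  have h := intervalIntegral.hasSum_integral_of_dominated_convergence (μ := volume)
    (a := 0) (b := Real.pi)
    (F := fun (k : ℕ) (θ : ℝ) => w ^ k * ((Real.sin ((k + 1) * θ) * Real.sin θ : ℝ) : ℂ))
    (f := fun θ => (Real.sin θ : ℂ) ^ 2 / (1 - 2 * w * Real.cos θ + w ^ 2))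
    (fun k _ => ‖w‖ ^ k)
    (fun k => Continuous.aestronglyMeasurable (by fun_prop))
    (fun k => Eventually.of_forall fun θ _ => by
      rw [norm_mul, norm_pow, Complex.norm_real, norm_mul]
      have h1 : ‖Real.sin ((k + 1) * θ)‖ ≤ 1 := Real.abs_sin_le_one _
      have h2 : ‖Real.sin θ‖ ≤ 1 := Real.abs_sin_le_one _
      exact mul_le_of_le_one_right (by positivity) (mul_le_one₀ h1 (norm_nonneg _) h2))
    (Eventually.of_forall fun θ _ => summable_geometric_of_lt_one (norm_nonneg _) hw)
    (by simp)
    (Eventually.of_forall fun θ _ => hasSum_pow_mul_sin_mul_sin hw θ)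
  have h2 : ∀ k : ℕ, ∫ θ in (0 : ℝ)..Real.pi,
      w ^ k * ((Real.sin ((k + 1) * θ) * Real.sin θ : ℝ) : ℂ) =
      if k = 0 then (Real.pi / 2 : ℂ) else 0 := by
    intro k
    rw [intervalIntegral.integral_const_mul, intervalIntegral.integral_ofReal,
      integral_sin_succ_mul_sin]
    split_ifs with hk
    · simp [hk]
    · simp
  simp only [h2] at h
  exact h.unique (hasSum_ite_eq 0 _)

/-- The inverse Joukowski parameter: points off `[-β, β]` are `(β / 2) (w + 1 / w)` with
`|w| < 1`. -/
lemma exists_joukowski {β : ℝ} (hβ : 0 < β) {z : ℂ}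
    (hz : z ∉ (fun x : ℝ => (x : ℂ)) '' Set.Icc (-β) β) :
    ∃ w : ℂ, w ≠ 0 ∧ ‖w‖ < 1 ∧ β * (w ^ 2 + 1) = 2 * z * w ∧
      2 / (β : ℂ) ^ 2 * (-z + z * Complex.sqrt (1 - (β : ℂ) ^ 2 / z ^ 2)) = -2 * w / β := by
  have hβ' : (β : ℂ) ≠ 0 := by exact_mod_cast hβ.ne'
  have hz0 : z ≠ 0 := by
    rintro rfl
    exact hz ⟨0, ⟨by linarith, by linarith⟩, by simp⟩
  set x : ℂ := 1 - (β : ℂ) ^ 2 / z ^ 2 with hx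
  set r := Complex.sqrt x with hr
  have hr2 : r ^ 2 = x := by
    rw [hr, Complex.sqrt, ← Complex.cpow_nat_mul]
    norm_num
  have hre : 0 < r.re := by
    rw [hr, Complex.sqrt, Complex.cpow_inv_two_re]
    apply Real.sqrt_pos.2
    by_contra hcon
    have h1 : ‖x‖ + x.re ≤ 0 := by linarith
    -- otherwise `x` is a nonpositive real and `z² = β² / (1 - x)` places `z` in `[-β, β]`
    have h2 : ‖x‖ = |x.re| := by
      apply le_antisymm _ (Complex.abs_re_le_norm x)
      linarith [neg_le_abs x.re]
    have h3 : x.im = 0 := (Complex.abs_re_eq_norm).1 h2.symm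
    have h4 : x.re ≤ 0 := by linarith [norm_nonneg x]
    have h5 : x = (x.re : ℂ) := Complex.ext (by simp) (by simp [h3])
    set c := x.re
    have h6 : 0 < 1 - c := by linarith
    have h7 : z ^ 2 = ((β / Real.sqrt (1 - c) : ℝ) : ℂ) ^ 2 := by
      rw [← Complex.ofReal_pow, div_pow, Real.sq_sqrt h6.le]
      have h8 : (1 - (c : ℂ)) ≠ 0 := by exact_mod_cast h6.ne'
      have h9 : (1 - (1 - (β : ℂ) ^ 2 / z ^ 2)) = (β : ℂ) ^ 2 / z ^ 2 := by ring
      push_cast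
      rw [← h5, hx, h9]
      field_simp
    have h10 : β / Real.sqrt (1 - c) ≤ β := by
      apply div_le_self hβ.le
      rw [Real.one_le_sqrt]
      linarith
    have h11 : 0 ≤ β / Real.sqrt (1 - c) := by positivity
    rcases sq_eq_sq_iff_eq_or_eq_neg.1 h7 with h | h
    · exact hz ⟨_, ⟨by linarith, h10⟩, h.symm⟩
    · exact hz ⟨-(β / Real.sqrt (1 - c)), ⟨by linarith, by linarith⟩, by rw [h]; push_cast; rfl⟩
  have hprod : (1 - r) * (1 + r) * z ^ 2 = (β : ℂ) ^ 2 := by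
    have : (1 - r) * (1 + r) = 1 - r ^ 2 := by ring
    rw [this, hr2, hx]
    field_simp
    ring
  have hlt : ‖1 - r‖ < ‖1 + r‖ := by
    rw [← sq_lt_sq₀ (norm_nonneg _) (norm_nonneg _), ← Complex.normSq_eq_norm_sq,
      ← Complex.normSq_eq_norm_sq, Complex.normSq_apply, Complex.normSq_apply]
    simp
    nlinarith
  refine ⟨z * (1 - r) / β, ?_, ?_, ?_, ?_⟩
  · refine div_ne_zero (mul_ne_zero hz0 fun h => ?_) hβ'
    rw [h] at hprod
    simp only [zero_mul] at hprod
    exact pow_ne_zero 2 hβ' hprod.symm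
  · rw [norm_div, norm_mul, Complex.norm_real, Real.norm_of_nonneg hβ.le, div_lt_one hβ]
    have h1 := congrArg norm hprod
    rw [norm_mul, norm_mul, norm_pow, norm_pow, Complex.norm_real, Real.norm_of_nonneg hβ.le] at h1
    have h2 : 0 < ‖z‖ := norm_pos_iff.2 hz0
    have h3 : (‖z‖ * ‖1 - r‖) ^ 2 < β ^ 2 := by
      have h4 : ‖1 - r‖ ≠ 0 := by
        intro h0
        rw [h0] at h1
        nlinarith
      have h5 : 0 < ‖1 - r‖ := lt_of_le_of_ne (norm_nonneg _) h4.symm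
      have h6 : ‖1 - r‖ * ‖1 - r‖ * ‖z‖ ^ 2 < ‖1 - r‖ * ‖1 + r‖ * ‖z‖ ^ 2 := by gcongr
      nlinarith
    exact lt_of_pow_lt_pow_left₀ 2 hβ.le h3
  · field_simp
    linear_combination (-1) * hprod
  · field_simp
    ring

lemma integrable_semicircleLaw {β : ℝ} (hβ : 0 < β) {f : ℝ → ℂ}
    (hf : ContinuousOn f (Set.Icc (-β) β)) : Integrable f (semicircleLaw β) := by
  have hprob := isProbabilityMeasure_semicircleLaw hβ
  have h1 : (semicircleLaw β).restrict (Set.Icc (-β) β) = semicircleLaw β := by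
    refine Measure.restrict_eq_self_of_ae_mem ?_
    rw [← support_semicircleLaw hβ]
    exact Measure.support_mem_ae
  rw [← h1]
  exact hf.integrableOn_compact isCompact_Icc

/-- The Stieltjes transform of the semicircle law, in the Joukowski parametrization. -/
lemma integral_one_div_sub_semicircleLaw {β : ℝ} (hβ : 0 < β) {z w : ℂ}
    (hz : z ∉ (fun x : ℝ => (x : ℂ)) '' Set.Icc (-β) β) (hw0 : w ≠ 0) (hw : ‖w‖ < 1)
    (hzw : β * (w ^ 2 + 1) = 2 * z * w) :
    ∫ t : ℝ, 1 / ((t : ℂ) - z) ∂(semicircleLaw β) = -2 * w / β := by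
  have hβ' : (β : ℂ) ≠ 0 := by exact_mod_cast hβ.ne'
  have hne : ∀ t ∈ Set.Icc (-β) β, (t : ℂ) - z ≠ 0 := fun t ht h =>
    hz ⟨t, ht, sub_eq_zero.1 h⟩
  rw [integral_semicircleLaw (f := fun t : ℝ => 1 / ((t : ℂ) - z)) hβ
    (ContinuousOn.div (by fun_prop) (by fun_prop) hne)]
  have h1 : ∀ θ : ℝ, Real.sin θ ^ 2 • (1 / (((β * Real.cos θ : ℝ) : ℂ) - z)) =
      (-2 * w / β) * ((Real.sin θ : ℂ) ^ 2 / (1 - 2 * w * Real.cos θ + w ^ 2)) := by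
    intro θ
    have h2 : ((β * Real.cos θ : ℝ) : ℂ) - z ≠ 0 := by
      apply hne
      constructor <;> nlinarith [Real.neg_one_le_cos θ, Real.cos_le_one θ]
    have h3 : (1 - 2 * w * Real.cos θ + w ^ 2) =
        -(2 * w / β) * (((β * Real.cos θ : ℝ) : ℂ) - z) := by
      push_cast
      field_simp
      linear_combination hzw
    rw [h3, Complex.real_smul]
    push_cast at h2 ⊢
    field_simp
  simp only [h1]
  rw [intervalIntegral.integral_const_mul, integral_sin_sq_div hw, Complex.real_smul]
  have : (Real.pi : ℂ) ≠ 0 := by exact_mod_cast Real.pi_ne_zero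
  push_cast
  field_simp

lemma continuousOn_one_div_sub {β : ℝ} {z : ℂ}
    (hz : z ∉ (fun x : ℝ => (x : ℂ)) '' Set.Icc (-β) β) :
    ContinuousOn (fun t : ℝ => 1 / ((t : ℂ) - z)) (Set.Icc (-β) β) :=
  ContinuousOn.div (by fun_prop) (by fun_prop) fun t ht h => hz ⟨t, ht, sub_eq_zero.1 h⟩

lemma notMem_image_ofReal_of_im_pos {z : ℂ} (hz : 0 < z.im) (s : Set ℝ) :
    z ∉ (fun x : ℝ => (x : ℂ)) '' s := by
  rintro ⟨x, -, rfl⟩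
  simp at hz

lemma integral_one_div_sub_eq_stieltjesM {d : ℕ} (hd : 2 ≤ d) {z : ℂ}
    (hz : z ∉ (fun x : ℝ => (x : ℂ)) '' Set.Icc (-betaEdge d) (betaEdge d)) :
    ∫ t : ℝ, 1 / ((t : ℂ) - z) ∂(semicircleLaw (betaEdge d)) = stieltjesM d z := by
  obtain ⟨w, hw0, hw1, hzw, hm⟩ := exists_joukowski (betaEdge_pos hd) hz
  rw [integral_one_div_sub_semicircleLaw (betaEdge_pos hd) hz hw0 hw1 hzw, stieltjesM, hm]

/-- The quadratic equation satisfied by the Stieltjes transform of the semicircle law. -/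
lemma stieltjesM_quadratic {d : ℕ} (hd : 2 ≤ d) {z : ℂ}
    (hz : z ∉ (fun x : ℝ => (x : ℂ)) '' Set.Icc (-betaEdge d) (betaEdge d)) :
    (betaEdge d : ℂ) ^ 2 / 4 * stieltjesM d z ^ 2 + z * stieltjesM d z + 1 = 0 := by
  obtain ⟨w, hw0, hw1, hzw, hm⟩ := exists_joukowski (betaEdge_pos hd) hz
  have hβ' : (betaEdge d : ℂ) ≠ 0 := by exact_mod_cast (betaEdge_pos hd).ne'
  rw [stieltjesM, hm]
  field_simp
  linear_combination 4 * hzw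

lemma im_one_div_ofReal_sub (t : ℝ) (z : ℂ) :
    (1 / ((t : ℂ) - z)).im = z.im / Complex.normSq ((t : ℂ) - z) := by
  rw [one_div, Complex.inv_im]
  simp

lemma stieltjesM_im_nonneg {d : ℕ} (hd : 2 ≤ d) {z : ℂ} (hz : 0 < z.im) :
    0 ≤ (stieltjesM d z).im := by
  have hz' := notMem_image_ofReal_of_im_pos hz (Set.Icc (-betaEdge d) (betaEdge d))
  rw [← integral_one_div_sub_eq_stieltjesM hd hz']
  have h := integral_im (𝕜 := ℂ)
    (integrable_semicircleLaw (betaEdge_pos hd) (continuousOn_one_div_sub hz'))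
  simp only [RCLike.im_to_complex] at h
  rw [← h]
  refine integral_nonneg fun t => ?_
  simp only [im_one_div_ofReal_sub, Pi.zero_apply]
  exact div_nonneg hz.le (Complex.normSq_nonneg _)

/-! ### Weak convergence from convergence of Stieltjes transforms -/

lemma abs_im_le_norm_ofReal_sub (t : ℝ) (z : ℂ) : |z.im| ≤ ‖(t : ℂ) - z‖ := by
  have h := Complex.abs_im_le_norm ((t : ℂ) - z)
  simpa using h

lemma ofReal_sub_ne_zero {z : ℂ} (hz : z.im ≠ 0) (t : ℝ) : (t : ℂ) - z ≠ 0 := by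
  rw [← norm_pos_iff]
  exact lt_of_lt_of_le (abs_pos.2 hz) (abs_im_le_norm_ofReal_sub t z)

lemma norm_one_div_ofReal_sub_le {z : ℂ} (hz : z.im ≠ 0) (t : ℝ) :
    ‖1 / ((t : ℂ) - z)‖ ≤ 1 / |z.im| := by
  rw [norm_div, norm_one]
  exact one_div_le_one_div_of_le (abs_pos.2 hz) (abs_im_le_norm_ofReal_sub t z)

/-- The bounded continuous function `t ↦ 1 / (t - z)` for a non-real number `z`. -/
noncomputable def stieltjesKernel (z : ℂ) (hz : z.im ≠ 0) : ℝ →ᵇ ℂ :=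
  BoundedContinuousFunction.ofNormedAddCommGroup (fun t : ℝ => 1 / ((t : ℂ) - z))
    (Continuous.div (by fun_prop) (by fun_prop) (ofReal_sub_ne_zero hz)) (1 / |z.im|)
    (norm_one_div_ofReal_sub_le hz)

lemma stieltjesKernel_apply {z : ℂ} (hz : z.im ≠ 0) (t : ℝ) :
    stieltjesKernel z hz t = 1 / ((t : ℂ) - z) := rfl

lemma norm_stieltjesKernel_sub_le {z w : ℂ} (hz : z.im ≠ 0) (hw : w.im ≠ 0) :
    ‖stieltjesKernel z hz - stieltjesKernel w hw‖ ≤ ‖z - w‖ / (|z.im| * |w.im|) := by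
  refine (BoundedContinuousFunction.norm_le (by positivity)).2 fun t => ?_
  have h1 := ofReal_sub_ne_zero hz t
  have h2 := ofReal_sub_ne_zero hw t
  have h3 : 1 / ((t : ℂ) - z) - 1 / ((t : ℂ) - w) = (z - w) / (((t : ℂ) - z) * ((t : ℂ) - w)) := by
    field_simp
    ring
  rw [BoundedContinuousFunction.sub_apply, stieltjesKernel_apply, stieltjesKernel_apply, h3,
    norm_div, norm_mul]
  have := abs_pos.2 hz
  have := abs_pos.2 hw
  gcongr
  · exact abs_im_le_norm_ofReal_sub t z
  · exact abs_im_le_norm_ofReal_sub t w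

lemma stieltjesKernel_mul {z w : ℂ} (hz : z.im ≠ 0) (hw : w.im ≠ 0) (hzw : z ≠ w) :
    stieltjesKernel z hz * stieltjesKernel w hw =
      (z - w)⁻¹ • (stieltjesKernel z hz - stieltjesKernel w hw) := by
  ext t
  have h1 := ofReal_sub_ne_zero hz t
  have h2 := ofReal_sub_ne_zero hw t
  have h3 : z - w ≠ 0 := sub_ne_zero.2 hzw
  simp only [BoundedContinuousFunction.mul_apply, BoundedContinuousFunction.smul_apply,
    BoundedContinuousFunction.sub_apply, stieltjesKernel_apply, smul_eq_mul]
  field_simp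
  ring

lemma star_stieltjesKernel {z : ℂ} (hz : z.im ≠ 0) :
    star (stieltjesKernel z hz) =
      stieltjesKernel (starRingEnd ℂ z) (by simpa using hz) := by
  ext t
  simp [stieltjesKernel_apply]

/-- The span of the constants and the Stieltjes kernels. -/
noncomputable def stieltjesSpan : Submodule ℂ (ℝ →ᵇ ℂ) :=
  Submodule.span ℂ ({1} ∪ {f | ∃ (z : ℂ) (hz : z.im ≠ 0), f = stieltjesKernel z hz})

lemma stieltjesKernel_mem_span {z : ℂ} (hz : z.im ≠ 0) : stieltjesKernel z hz ∈ stieltjesSpan :=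
  Submodule.subset_span (Or.inr ⟨z, hz, rfl⟩)

lemma one_mem_stieltjesSpan : 1 ∈ stieltjesSpan := Submodule.subset_span (Or.inl rfl)

/-- The product of two Stieltjes kernels at distinct points is a combination of both by partial
fractions; the square of a kernel is a limit of such products. -/
lemma stieltjesKernel_mul_mem_closure {z w : ℂ} (hz : z.im ≠ 0) (hw : w.im ≠ 0) :
    stieltjesKernel z hz * stieltjesKernel w hw ∈ stieltjesSpan.topologicalClosure := by
  have hne : ∀ {w : ℂ} (hw : w.im ≠ 0), z ≠ w →
      stieltjesKernel z hz * stieltjesKernel w hw ∈ stieltjesSpan := by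
    intro w hw hzw
    rw [stieltjesKernel_mul hz hw hzw]
    exact Submodule.smul_mem _ _
      (Submodule.sub_mem _ (stieltjesKernel_mem_span hz) (stieltjesKernel_mem_span hw))
  by_cases hzw : z = w
  · subst hzw
    have him : ∀ n : ℕ, (z + ((1 / ((n : ℝ) + 1) : ℝ) : ℂ)).im ≠ 0 := by
      intro n
      simpa only [Complex.add_im, Complex.ofReal_im, add_zero] using hz
    have hlim : Tendsto (fun n : ℕ => stieltjesKernel (z + ((1 / ((n : ℝ) + 1) : ℝ) : ℂ)) (him n))
        atTop (𝓝 (stieltjesKernel z hz)) := by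
      rw [tendsto_iff_norm_sub_tendsto_zero]
      refine squeeze_zero (fun n => norm_nonneg _)
        (fun n => norm_stieltjesKernel_sub_le (him n) hz) ?_
      have h : Tendsto (fun n : ℕ => 1 / ((n : ℝ) + 1) / (|z.im| * |z.im|)) atTop
          (𝓝 (0 / (|z.im| * |z.im|))) :=
        tendsto_one_div_add_atTop_nhds_zero_nat.div_const _
      rw [zero_div] at h
      refine h.congr fun n => ?_
      rw [add_sub_cancel_left, Complex.norm_real, Real.norm_of_nonneg (by positivity),
        Complex.add_im, Complex.ofReal_im, add_zero]
    refine mem_closure_of_tendsto (hlim.const_mul (stieltjesKernel z hz))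
      (Eventually.of_forall fun n => ?_)
    refine hne (him n) fun h => ?_
    have h2 : ((1 / ((n : ℝ) + 1) : ℝ) : ℂ) = 0 := by linear_combination -h
    rw [Complex.ofReal_eq_zero] at h2
    have : (0 : ℝ) < 1 / ((n : ℝ) + 1) := by positivity
    linarith
  · exact Submodule.le_topologicalClosure _ (hne hw hzw)

lemma mul_mem_closure_stieltjesSpan {f g : ℝ →ᵇ ℂ} (hf : f ∈ stieltjesSpan)
    (hg : g ∈ stieltjesSpan) : f * g ∈ stieltjesSpan.topologicalClosure := by
  have hle := stieltjesSpan.le_topologicalClosure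
  induction hf, hg using Submodule.span_induction₂ with
  | mem_mem f g hf hg =>
    rcases hf with rfl | ⟨z, hz, rfl⟩
    · rw [one_mul]
      exact hle (Submodule.subset_span hg)
    · rcases hg with rfl | ⟨w, hw, rfl⟩
      · rw [mul_one]
        exact hle (stieltjesKernel_mem_span hz)
      · exact stieltjesKernel_mul_mem_closure hz hw
  | zero_left g hg => rw [zero_mul]; exact Submodule.zero_mem _
  | zero_right f hf => rw [mul_zero]; exact Submodule.zero_mem _
  | add_left f₁ f₂ g _ _ _ h₁ h₂ => rw [add_mul]; exact Submodule.add_mem _ h₁ h₂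
  | add_right f g₁ g₂ _ _ _ h₁ h₂ => rw [mul_add]; exact Submodule.add_mem _ h₁ h₂
  | smul_left c f g _ _ h => rw [smul_mul_assoc]; exact Submodule.smul_mem _ _ h
  | smul_right c f g _ _ h => rw [mul_smul_comm]; exact Submodule.smul_mem _ _ h

lemma star_mem_stieltjesSpan {f : ℝ →ᵇ ℂ} (hf : f ∈ stieltjesSpan) : star f ∈ stieltjesSpan := by
  induction hf using Submodule.span_induction with
  | mem f hf =>
    rcases hf with rfl | ⟨z, hz, rfl⟩
    · rw [star_one]
      exact one_mem_stieltjesSpan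
    · rw [star_stieltjesKernel]
      exact stieltjesKernel_mem_span _
  | zero => rw [star_zero]; exact Submodule.zero_mem _
  | add f g _ _ hf hg => rw [star_add]; exact Submodule.add_mem _ hf hg
  | smul c f _ hf => rw [star_smul]; exact Submodule.smul_mem _ _ hf

/-- The closed star algebra generated by the Stieltjes kernels: it is just the closure of their
span with the constants. -/
noncomputable def stieltjesAlgebra : StarSubalgebra ℂ (ℝ →ᵇ ℂ) where
  carrier := stieltjesSpan.topologicalClosure
  mul_mem' := by
    intro f g hf hg
    have h := map_mem_closure₂ (s := (stieltjesSpan : Set (ℝ →ᵇ ℂ)))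
      (t := (stieltjesSpan : Set (ℝ →ᵇ ℂ)))
      (u := (stieltjesSpan.topologicalClosure : Set (ℝ →ᵇ ℂ)))
      continuous_mul hf hg fun f hf g hg => mul_mem_closure_stieltjesSpan hf hg
    rwa [stieltjesSpan.isClosed_topologicalClosure.closure_eq] at h
  add_mem' := fun hf hg => Submodule.add_mem _ hf hg
  algebraMap_mem' := by
    intro c
    rw [Algebra.algebraMap_eq_smul_one]
    exact Submodule.smul_mem _ _ (stieltjesSpan.le_topologicalClosure one_mem_stieltjesSpan)
  star_mem' := by
    intro f hf
    exact map_mem_closure continuous_star hf fun f hf => star_mem_stieltjesSpan hf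

lemma separatesPoints_stieltjesAlgebra :
    (stieltjesAlgebra.map (BoundedContinuousFunction.toContinuousMapStarₐ ℂ)).SeparatesPoints := by
  intro x y hxy
  have hI : Complex.I.im ≠ 0 := by simp
  refine ⟨stieltjesKernel Complex.I hI, ⟨_, ⟨stieltjesKernel Complex.I hI,
    stieltjesSpan.le_topologicalClosure (stieltjesKernel_mem_span hI), rfl⟩, rfl⟩, ?_⟩
  intro h
  apply hxy
  rw [stieltjesKernel_apply, stieltjesKernel_apply, one_div, one_div, inv_inj, sub_left_inj] at h
  exact_mod_cast h

/-- The functions whose integrals converge along a sequence of probability measures form a closed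
subspace. -/
noncomputable def convergenceSubmodule (μ : ℕ → Measure ℝ) [∀ n, IsProbabilityMeasure (μ n)]
    (ρ : Measure ℝ) [IsProbabilityMeasure ρ] : Submodule ℂ (ℝ →ᵇ ℂ) where
  carrier := {f | Tendsto (fun n => ∫ x, f x ∂(μ n)) atTop (𝓝 (∫ x, f x ∂ρ))}
  add_mem' := by
    intro f g hf hg
    simp only [Set.mem_ofPred_eq, BoundedContinuousFunction.add_apply] at hf hg ⊢
    have h : ∀ (ν : Measure ℝ) [IsProbabilityMeasure ν], ∫ x, f x + g x ∂ν =
      ∫ x, f x ∂ν + ∫ x, g x ∂ν := fun ν _ => integral_add (f.integrable ν) (g.integrable ν)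
    simp only [h]
    exact hf.add hg
  zero_mem' := by simp
  smul_mem' := by
    intro c f hf
    simp only [Set.mem_ofPred_eq, BoundedContinuousFunction.smul_apply, integral_smul] at hf ⊢
    exact hf.const_smul c

lemma mem_convergenceSubmodule {μ : ℕ → Measure ℝ} [∀ n, IsProbabilityMeasure (μ n)]
    {ρ : Measure ℝ} [IsProbabilityMeasure ρ] {f : ℝ →ᵇ ℂ} :
    f ∈ convergenceSubmodule μ ρ ↔
      Tendsto (fun n => ∫ x, f x ∂(μ n)) atTop (𝓝 (∫ x, f x ∂ρ)) := Iff.rfl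

lemma norm_integral_sub_le (ν : Measure ℝ) [IsProbabilityMeasure ν] (f g : ℝ →ᵇ ℂ) :
    ‖∫ x, f x ∂ν - ∫ x, g x ∂ν‖ ≤ ‖f - g‖ := by
  rw [← integral_sub (f.integrable ν) (g.integrable ν)]
  have h := (f - g).norm_integral_le_mul_norm ν
  simpa using h

lemma isClosed_convergenceSubmodule (μ : ℕ → Measure ℝ) [∀ n, IsProbabilityMeasure (μ n)]
    (ρ : Measure ℝ) [IsProbabilityMeasure ρ] :
    IsClosed (convergenceSubmodule μ ρ : Set (ℝ →ᵇ ℂ)) := by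
  refine isClosed_of_closure_subset fun f hf => ?_
  rw [SetLike.mem_coe, mem_convergenceSubmodule, Metric.tendsto_atTop]
  intro ε hε
  obtain ⟨g, hg, hfg⟩ := Metric.mem_closure_iff.1 hf (ε / 3) (by positivity)
  rw [SetLike.mem_coe, mem_convergenceSubmodule, Metric.tendsto_atTop] at hg
  obtain ⟨n₀, hn₀⟩ := hg (ε / 3) (by positivity)
  refine ⟨n₀, fun n hn => ?_⟩
  have h1 := norm_integral_sub_le (μ n) f g
  have h2 := norm_integral_sub_le ρ f g
  have h3 := hn₀ n hn
  rw [dist_eq_norm] at h3 hfg ⊢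
  have h4 : ∫ x, f x ∂(μ n) - ∫ x, f x ∂ρ = (∫ x, f x ∂(μ n) - ∫ x, g x ∂(μ n)) +
      (∫ x, g x ∂(μ n) - ∫ x, g x ∂ρ) - (∫ x, f x ∂ρ - ∫ x, g x ∂ρ) := by ring
  rw [h4]
  calc _ ≤ _ := norm_sub_le _ _
    _ ≤ _ := add_le_add_left (norm_add_le _ _) _
    _ < ε := by linarith

/-- Convergence of the Stieltjes transforms on a dense subset of the upper half-plane gives
convergence of the integrals of all functions in the closed algebra of Stieltjes kernels. -/
lemma stieltjesSpan_closure_le {μ : ℕ → Measure ℝ} [∀ n, IsProbabilityMeasure (μ n)]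
    {ρ : Measure ℝ} [IsProbabilityMeasure ρ] {D : Set ℂ} (hD : Dense D)
    (h : ∀ z ∈ D, 0 < z.im → Tendsto (fun n => ∫ x : ℝ, 1 / ((x : ℂ) - z) ∂(μ n)) atTop
      (𝓝 (∫ x : ℝ, 1 / ((x : ℂ) - z) ∂ρ))) :
    stieltjesSpan.topologicalClosure ≤ convergenceSubmodule μ ρ := by
  refine Submodule.topologicalClosure_minimal _ ?_ (isClosed_convergenceSubmodule μ ρ)
  have hpos : ∀ (z : ℂ) (hz : 0 < z.im), stieltjesKernel z hz.ne' ∈ convergenceSubmodule μ ρ := by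
    intro z hz
    rw [← SetLike.mem_coe, ← (isClosed_convergenceSubmodule μ ρ).closure_eq, Metric.mem_closure_iff]
    intro ε hε
    obtain ⟨w, hwD, hw⟩ := Metric.mem_closure_iff.1 (hD z)
      (min (z.im / 2) (ε * (z.im * (z.im / 2))))
      (lt_min (by positivity) (by positivity))
    rw [dist_eq_norm] at hw
    have h1 : z.im - w.im ≤ ‖z - w‖ := by
      have := (le_abs_self _).trans (Complex.abs_im_le_norm (z - w))
      simpa using this
    have h2 : z.im / 2 < w.im := by linarith [hw.trans_le (min_le_left _ _)]
    have h3 : 0 < w.im := by linarith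
    refine ⟨stieltjesKernel w h3.ne', ?_, ?_⟩
    · exact h w hwD h3
    · rw [dist_eq_norm]
      refine (norm_stieltjesKernel_sub_le hz.ne' h3.ne').trans_lt ?_
      rw [abs_of_pos hz, abs_of_pos h3, div_lt_iff₀ (by positivity)]
      refine (hw.trans_le (min_le_right _ _)).trans_le ?_
      gcongr
  refine Submodule.span_le.2 ?_
  rintro f (rfl | ⟨z, hz, rfl⟩)
  · rw [SetLike.mem_coe, mem_convergenceSubmodule]
    simp
  · rcases lt_or_gt_of_ne hz with hz' | hz'
    · have h1 := mem_convergenceSubmodule.1 (hpos (starRingEnd ℂ z) (by simpa using hz'))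
      rw [SetLike.mem_coe, mem_convergenceSubmodule]
      have h2 : ∀ ν : Measure ℝ, ∫ x, stieltjesKernel z hz x ∂ν =
          starRingEnd ℂ (∫ x, stieltjesKernel (starRingEnd ℂ z) (by simpa using hz) x ∂ν) := by
        intro ν
        rw [← integral_conj]
        refine integral_congr_ae (Eventually.of_forall fun t => ?_)
        simp [stieltjesKernel_apply]
      simp only [h2]
      exact (Complex.continuous_conj.tendsto _).comp h1
    · exact hpos z hz'

lemma sq_div_sq_add_sq_eq_re {r : ℝ} (hr : 0 < r) (x : ℝ) :
    x ^ 2 / (x ^ 2 + r ^ 2) = 1 - r * (1 / ((x : ℂ) - r * Complex.I)).im := by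
  rw [one_div, Complex.inv_im, Complex.normSq_apply]
  have : x ^ 2 + r ^ 2 ≠ 0 := by positivity
  simp
  field_simp
  ring

lemma integrable_im_stieltjesKernel (ν : Measure ℝ) [IsProbabilityMeasure ν] {r : ℝ} (hr : 0 < r) :
    Integrable (fun x : ℝ => (1 / ((x : ℂ) - r * Complex.I)).im) ν :=
  ((stieltjesKernel (r * Complex.I) (by simpa using hr.ne')).integrable ν).im

lemma integral_sq_div_sq_add_sq (ν : Measure ℝ) [IsProbabilityMeasure ν] {r : ℝ} (hr : 0 < r) :
    ∫ x : ℝ, x ^ 2 / (x ^ 2 + r ^ 2) ∂ν =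
      1 - r * (∫ x : ℝ, 1 / ((x : ℂ) - r * Complex.I) ∂ν).im := by
  have h2 := integral_im (𝕜 := ℂ)
    ((stieltjesKernel (r * Complex.I) (by simpa using hr.ne')).integrable ν)
  simp only [RCLike.im_to_complex, stieltjesKernel_apply] at h2
  simp only [sq_div_sq_add_sq_eq_re hr]
  rw [integral_sub (integrable_const _) ((integrable_im_stieltjesKernel ν hr).const_mul r),
    integral_const_mul, h2]
  simp

/-- The function `x² / (x² + r²)`, which dominates half of the indicator of `|x| > r`, is a
combination of a constant and the imaginary part of a Stieltjes kernel. -/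
lemma measure_norm_gt_le (ν : Measure ℝ) [IsProbabilityMeasure ν] {r : ℝ} (hr : 0 < r) :
    ν {x | r < ‖x‖} ≤
      ENNReal.ofReal (2 * (1 - r * (∫ x : ℝ, 1 / ((x : ℂ) - r * Complex.I) ∂ν).im)) := by
  have hint : Integrable (fun x : ℝ => 2 * (x ^ 2 / (x ^ 2 + r ^ 2))) ν := by
    simp only [sq_div_sq_add_sq_eq_re hr]
    exact ((integrable_const _).sub ((integrable_im_stieltjesKernel ν hr).const_mul r)).const_mul 2
  rw [← integral_sq_div_sq_add_sq ν hr, ← integral_const_mul,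
    ofReal_integral_eq_lintegral_ofReal hint (Eventually.of_forall fun x => by positivity)]
  calc ν {x | r < ‖x‖} = ∫⁻ x in {x | r < ‖x‖}, 1 ∂ν := by simp
    _ ≤ ∫⁻ x in {x | r < ‖x‖}, ENNReal.ofReal (2 * (x ^ 2 / (x ^ 2 + r ^ 2))) ∂ν := by
      refine setLIntegral_mono (by fun_prop) fun x hx => ?_
      rw [Set.mem_ofPred_eq, Real.norm_eq_abs] at hx
      rw [ENNReal.one_le_ofReal, mul_div_assoc', le_div_iff₀ (by positivity)]
      have h3 : r ^ 2 < x ^ 2 := by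
        rw [← sq_abs x]
        gcongr
      linarith
    _ ≤ _ := setLIntegral_le_lintegral _ _

lemma tendsto_integral_sq_div (ρ : Measure ℝ) [IsProbabilityMeasure ρ] :
    Tendsto (fun r : ℝ => 2 * (1 - r * (∫ x : ℝ, 1 / ((x : ℂ) - r * Complex.I) ∂ρ).im)) atTop
      (𝓝 0) := by
  have h0 : Tendsto (fun r : ℝ => ∫ x : ℝ, x ^ 2 / (x ^ 2 + r ^ 2) ∂ρ) atTop
      (𝓝 (∫ _ : ℝ, 0 ∂ρ)) := by
    refine tendsto_integral_filter_of_dominated_convergence (fun _ => 1) ?_ ?_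
      (integrable_const _) ?_
    · exact Eventually.of_forall fun r => Measurable.aestronglyMeasurable (by fun_prop)
    · refine Eventually.of_forall fun r => Eventually.of_forall fun x => ?_
      rw [Real.norm_of_nonneg (by positivity)]
      exact div_le_one_of_le₀ (by nlinarith [sq_nonneg r]) (by positivity)
    · refine Eventually.of_forall fun x => ?_
      refine Tendsto.const_div_atTop ?_ _
      exact tendsto_atTop_add_const_left _ _ (tendsto_pow_atTop two_ne_zero)
  rw [integral_zero] at h0
  have h1 := h0.const_mul 2
  rw [mul_zero] at h1
  refine h1.congr' ?_
  filter_upwards [eventually_gt_atTop 0] with r hr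
  rw [integral_sq_div_sq_add_sq ρ hr]

lemma isTightMeasureSet_of_tendsto_stieltjes {μ : ℕ → Measure ℝ}
    [∀ n, IsProbabilityMeasure (μ n)] {ρ : Measure ℝ} [IsProbabilityMeasure ρ]
    (h : ∀ z : ℂ, 0 < z.im → Tendsto (fun n => ∫ x : ℝ, 1 / ((x : ℂ) - z) ∂(μ n)) atTop
      (𝓝 (∫ x : ℝ, 1 / ((x : ℂ) - z) ∂ρ))) :
    IsTightMeasureSet (Set.range μ) := by
  refine isTightMeasureSet_range_of_tendsto_limsup_measure_norm_gt ?_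
  have h1 := ENNReal.tendsto_ofReal (tendsto_integral_sq_div ρ)
  rw [ENNReal.ofReal_zero] at h1
  refine tendsto_of_tendsto_of_tendsto_of_le_of_le' tendsto_const_nhds h1
    (Eventually.of_forall fun _ => zero_le) ?_
  filter_upwards [eventually_gt_atTop 0] with r hr
  have h2 : Tendsto (fun n => ENNReal.ofReal
      (2 * (1 - r * (∫ x : ℝ, 1 / ((x : ℂ) - r * Complex.I) ∂(μ n)).im))) atTop
      (𝓝 (ENNReal.ofReal (2 * (1 - r * (∫ x : ℝ, 1 / ((x : ℂ) - r * Complex.I) ∂ρ).im)))) := by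
    refine ENNReal.tendsto_ofReal (Tendsto.const_mul _ (tendsto_const_nhds.sub
      (Tendsto.const_mul _ ?_)))
    exact (Complex.continuous_im.tendsto _).comp (h (r * Complex.I) (by simpa using hr))
  rw [← h2.limsup_eq]
  exact limsup_le_limsup (Eventually.of_forall fun n => measure_norm_gt_le (μ n) hr)

/-- Pointwise convergence of Stieltjes transforms on a dense set of the upper half-plane implies
weak convergence of probability measures. -/
theorem tendsto_integral_of_tendsto_stieltjes {μ : ℕ → Measure ℝ}
    [hμ : ∀ n, IsProbabilityMeasure (μ n)] {ρ : Measure ℝ} [hρ : IsProbabilityMeasure ρ] {D : Set ℂ}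
    (hD : Dense D)
    (h : ∀ z ∈ D, 0 < z.im → Tendsto (fun n => ∫ x : ℝ, 1 / ((x : ℂ) - z) ∂(μ n)) atTop
      (𝓝 (∫ x : ℝ, 1 / ((x : ℂ) - z) ∂ρ))) (f : ℝ →ᵇ ℝ) :
    Tendsto (fun n => ∫ x, f x ∂(μ n)) atTop (𝓝 (∫ x, f x ∂ρ)) := by
  have hle := stieltjesSpan_closure_le hD h
  have hall : ∀ z : ℂ, 0 < z.im → Tendsto (fun n => ∫ x : ℝ, 1 / ((x : ℂ) - z) ∂(μ n)) atTop
      (𝓝 (∫ x : ℝ, 1 / ((x : ℂ) - z) ∂ρ)) := fun z hz =>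
    hle (stieltjesSpan.le_topologicalClosure (stieltjesKernel_mem_span hz.ne'))
  have htight := isTightMeasureSet_of_tendsto_stieltjes hall
  let μ' : ℕ → ProbabilityMeasure ℝ := fun n => ⟨μ n, hμ n⟩
  let ρ' : ProbabilityMeasure ℝ := ⟨ρ, hρ⟩
  have hconv : Tendsto μ' atTop (𝓝 ρ') :=
    ProbabilityMeasure.tendsto_of_tight_of_separatesPoints ℂ (μ := μ') (μ₀ := ρ')
      (by exact htight) separatesPoints_stieltjesAlgebra fun g hg => hle hg
  exact ProbabilityMeasure.tendsto_iff_forall_integral_tendsto.1 hconv f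

/-! ### Resolvents of real symmetric matrices -/

section Resolvent

open scoped Matrix Matrix.Norms.L2Operator

/-- The resolvent `(A - z)⁻¹` of a real matrix, as a complex matrix. -/
noncomputable def resolventMatrix {N : ℕ} (A : Matrix (Fin N) (Fin N) ℝ) (z : ℂ) :
    Matrix (Fin N) (Fin N) ℂ :=
  (A.map Complex.ofReal - z • 1)⁻¹

variable {N : ℕ} {A : Matrix (Fin N) (Fin N) ℝ} {z : ℂ}

/-- The spectral decomposition `A = U diag(λ) U*`, over `ℂ`. -/
lemma exists_unitary_map_ofReal_eq (hA : A.IsHermitian) :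
    ∃ U : Matrix (Fin N) (Fin N) ℂ, U ∈ unitary (Matrix (Fin N) (Fin N) ℂ) ∧
      A.map Complex.ofReal =
        U * Matrix.diagonal (fun i => ((hA.eigenvalues i : ℝ) : ℂ)) * star U := by
  have hU := hA.eigenvectorUnitary.2
  set V : Matrix (Fin N) (Fin N) ℝ := hA.eigenvectorUnitary.1
  have hstar : (star V).map Complex.ofReal = star (V.map Complex.ofReal) := by
    ext i j
    simp [Matrix.star_apply]
  have hmul : ∀ B C : Matrix (Fin N) (Fin N) ℝ,
      (B * C).map Complex.ofReal = B.map Complex.ofReal * C.map Complex.ofReal := fun B C =>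
    Matrix.map_mul (f := Complex.ofRealHom)
  have hone : (1 : Matrix (Fin N) (Fin N) ℝ).map Complex.ofReal = 1 :=
    Matrix.map_one _ Complex.ofReal_zero Complex.ofReal_one
  refine ⟨V.map Complex.ofReal, ?_, ?_⟩
  · rw [Unitary.mem_iff] at hU ⊢
    rw [← hstar, ← hmul, ← hmul, hU.1, hU.2]
    exact ⟨hone, hone⟩
  · have h := hA.spectral_theorem
    rw [Unitary.conjStarAlgAut_apply] at h
    conv_lhs => rw [h]
    rw [hmul, hmul, ← Unitary.coe_star, Unitary.coe_star, hstar]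
    congr 2
    rw [Matrix.diagonal_map Complex.ofReal_zero]
    rfl

lemma exists_unitary_resolventMatrix_eq (hA : A.IsHermitian) (hz : z.im ≠ 0) :
    ∃ U : Matrix (Fin N) (Fin N) ℂ, U ∈ unitary (Matrix (Fin N) (Fin N) ℂ) ∧
      (A.map Complex.ofReal - z • 1) * resolventMatrix A z = 1 ∧
      resolventMatrix A z =
        U * Matrix.diagonal (fun i => 1 / (((hA.eigenvalues i : ℝ) : ℂ) - z)) * star U := by
  obtain ⟨U, hU, hAU⟩ := exists_unitary_map_ofReal_eq hA
  have hU' := Unitary.mem_iff.1 hU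
  have hne : ∀ i, ((hA.eigenvalues i : ℝ) : ℂ) - z ≠ 0 := by
    intro i h
    apply hz
    have := congrArg Complex.im h
    simpa using this
  have h1 : A.map Complex.ofReal - z • 1 =
      U * Matrix.diagonal (fun i => ((hA.eigenvalues i : ℝ) : ℂ) - z) * star U := by
    have h2 : Matrix.diagonal (fun i => ((hA.eigenvalues i : ℝ) : ℂ) - z) =
        Matrix.diagonal (fun i => ((hA.eigenvalues i : ℝ) : ℂ)) - z • 1 := by
      rw [Matrix.smul_one_eq_diagonal, Matrix.diagonal_sub]
    rw [h2, mul_sub, sub_mul, ← hAU, mul_smul_comm, mul_one, smul_mul_assoc, hU'.2]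
  have h3 : (A.map Complex.ofReal - z • 1) *
      (U * Matrix.diagonal (fun i => 1 / (((hA.eigenvalues i : ℝ) : ℂ) - z)) * star U) = 1 := by
    rw [h1]
    calc _ = U * Matrix.diagonal (fun i => ((hA.eigenvalues i : ℝ) : ℂ) - z) * (star U * U) *
          Matrix.diagonal (fun i => 1 / (((hA.eigenvalues i : ℝ) : ℂ) - z)) * star U := by
          simp only [mul_assoc]
      _ = U * (Matrix.diagonal (fun i => ((hA.eigenvalues i : ℝ) : ℂ) - z) *
          Matrix.diagonal (fun i => 1 / (((hA.eigenvalues i : ℝ) : ℂ) - z))) * star U := by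
          rw [hU'.1]
          simp only [mul_assoc, mul_one]
      _ = 1 := by
          rw [Matrix.diagonal_mul_diagonal]
          simp only [mul_one_div_cancel (hne _), Matrix.diagonal_one, mul_one, hU'.2]
  have h4 : resolventMatrix A z =
      U * Matrix.diagonal (fun i => 1 / (((hA.eigenvalues i : ℝ) : ℂ) - z)) * star U :=
    Matrix.inv_eq_right_inv h3
  exact ⟨U, hU, by rw [h4, h3], h4⟩

lemma sub_smul_one_mul_resolventMatrix (hA : A.IsHermitian) (hz : z.im ≠ 0) :
    (A.map Complex.ofReal - z • 1) * resolventMatrix A z = 1 := by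
  obtain ⟨U, -, h, -⟩ := exists_unitary_resolventMatrix_eq hA hz
  exact h

lemma resolventMatrix_mul_sub_smul_one (hA : A.IsHermitian) (hz : z.im ≠ 0) :
    resolventMatrix A z * (A.map Complex.ofReal - z • 1) = 1 :=
  mul_eq_one_comm.1 (sub_smul_one_mul_resolventMatrix hA hz)

lemma trace_resolventMatrix (hA : A.IsHermitian) (hz : z.im ≠ 0) :
    (resolventMatrix A z).trace = ∑ i, 1 / (((hA.eigenvalues i : ℝ) : ℂ) - z) := by
  obtain ⟨U, hU, -, h⟩ := exists_unitary_resolventMatrix_eq hA hz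
  rw [h, Matrix.trace_mul_comm, ← mul_assoc, (Unitary.mem_iff.1 hU).1, one_mul,
    Matrix.trace_diagonal]

lemma norm_resolventMatrix_le (hA : A.IsHermitian) (hz : z.im ≠ 0) :
    ‖resolventMatrix A z‖ ≤ 1 / |z.im| := by
  obtain ⟨U, hU, -, h⟩ := exists_unitary_resolventMatrix_eq hA hz
  rw [h, CStarRing.norm_mul_mem_unitary _ (Unitary.star_mem hU),
    CStarRing.norm_mem_unitary_mul _ hU,
    Matrix.l2_opNorm_diagonal, pi_norm_le_iff_of_nonneg (by positivity)]
  intro i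
  rw [norm_div, norm_one]
  refine one_div_le_one_div_of_le (abs_pos.2 hz) ?_
  have := Complex.abs_im_le_norm (((hA.eigenvalues i : ℝ) : ℂ) - z)
  simpa using this

lemma transpose_resolventMatrix (hA : A.IsHermitian) :
    (resolventMatrix A z)ᵀ = resolventMatrix A z := by
  have h : Aᵀ = A := by
    rw [← Matrix.conjTranspose_eq_transpose_of_trivial]
    exact hA
  rw [resolventMatrix, Matrix.transpose_nonsing_inv, Matrix.transpose_sub, Matrix.transpose_smul,
    Matrix.transpose_one, ← Matrix.transpose_map, h]

lemma resolventMatrix_sub (hA : A.IsHermitian) {B : Matrix (Fin N) (Fin N) ℝ}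
    (hB : B.IsHermitian) (hz : z.im ≠ 0) :
    resolventMatrix B z - resolventMatrix A z =
      -(resolventMatrix B z * (B - A).map Complex.ofReal * resolventMatrix A z) := by
  have h : (B - A).map Complex.ofReal =
      (B.map Complex.ofReal - z • 1) - (A.map Complex.ofReal - z • 1) := by
    rw [sub_sub_sub_cancel_right]
    ext i j
    simp
  rw [h, mul_sub, sub_mul, resolventMatrix_mul_sub_smul_one hB hz, one_mul, mul_assoc,
    sub_smul_one_mul_resolventMatrix hA hz, mul_one]
  abel

lemma continuous_resolventMatrix {X : Type*} [TopologicalSpace X]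
    {F : X → Matrix (Fin N) (Fin N) ℝ} (hF : Continuous F) (hherm : ∀ x, (F x).IsHermitian)
    (hz : z.im ≠ 0) : Continuous fun x => resolventMatrix (F x) z := by
  have hc : Continuous fun x => (F x).map Complex.ofReal - z • (1 : Matrix (Fin N) (Fin N) ℂ) :=
    (hF.matrix_map Complex.continuous_ofReal).sub continuous_const
  simp only [resolventMatrix, Matrix.inv_def, Ring.inverse_eq_inv']
  refine Continuous.smul (hc.matrix_det.inv₀ fun x h => ?_) hc.matrix_adjugate
  have h1 := congrArg Matrix.det (sub_smul_one_mul_resolventMatrix (hherm x) hz)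
  rw [Matrix.det_mul, h, zero_mul, Matrix.det_one] at h1
  exact zero_ne_one h1

lemma hasDerivAt_resolventMatrix (hA : A.IsHermitian) {R : Matrix (Fin N) (Fin N) ℝ}
    (hR : R.IsHermitian) (hz : z.im ≠ 0) (i j : Fin N) :
    HasDerivAt (fun t : ℝ => resolventMatrix (A + t • R) z i j)
      (-(resolventMatrix A z * R.map Complex.ofReal * resolventMatrix A z) i j) 0 := by
  have hherm : ∀ t : ℝ, (A + t • R).IsHermitian := fun t =>
    hA.add (hR.smul (IsSelfAdjoint.all t))
  have hc : Continuous fun t : ℝ => resolventMatrix (A + t • R) z :=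
    continuous_resolventMatrix (by fun_prop) hherm hz
  have hc2 : Continuous fun t : ℝ =>
      -(resolventMatrix (A + t • R) z * R.map Complex.ofReal * resolventMatrix A z) i j :=
    (((hc.matrix_mul continuous_const).matrix_mul continuous_const).matrix_elem i j).neg
  rw [hasDerivAt_iff_tendsto_slope]
  have h0 := hc2.tendsto 0
  simp only [zero_smul, add_zero] at h0
  refine (h0.mono_left nhdsWithin_le_nhds).congr' ?_
  filter_upwards [self_mem_nhdsWithin] with t ht
  have h1 := congrArg (fun M => M i j) (resolventMatrix_sub hA (hherm t) hz)
  have h2 : (A + t • R - A).map Complex.ofReal = (t : ℂ) • R.map Complex.ofReal := by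
    ext i j
    simp
  rw [h2, mul_smul_comm, smul_mul_assoc] at h1
  simp only [Matrix.sub_apply, Matrix.neg_apply, Matrix.smul_apply, smul_eq_mul] at h1
  have ht' : (t : ℂ) ≠ 0 := by exact_mod_cast ht
  rw [slope_def_module, zero_smul, add_zero, h1, sub_zero, Complex.real_smul]
  push_cast
  field_simp

/-! ### Norm bounds for traces and quadratic forms -/

/-- The bilinear value `∑ v_i B_ij v_j` of a complex matrix at a real vector. -/
noncomputable def realQuadForm (B : Matrix (Fin N) (Fin N) ℂ) (v : EuclideanSpace ℝ (Fin N)) : ℂ :=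
  ∑ i, ∑ j, (v i : ℂ) * B i j * (v j : ℂ)

lemma norm_realQuadForm_le (B : Matrix (Fin N) (Fin N) ℂ) {v : EuclideanSpace ℝ (Fin N)}
    (hv : ‖v‖ = 1) : ‖realQuadForm B v‖ ≤ ‖B‖ := by
  set x : EuclideanSpace ℂ (Fin N) := WithLp.toLp 2 fun i => (v i : ℂ) with hx
  have hxn : ‖x‖ = 1 := by
    rw [← hv, EuclideanSpace.norm_eq, EuclideanSpace.norm_eq]
    simp [hx]
  have h : realQuadForm B v = inner ℂ x (WithLp.toLp 2 (B *ᵥ x.ofLp)) := by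
    rw [realQuadForm, PiLp.inner_apply]
    refine Finset.sum_congr rfl fun i _ => ?_
    simp only [hx, Matrix.mulVec, dotProduct, RCLike.inner_apply, Complex.conj_ofReal,
      Finset.sum_mul]
    exact Finset.sum_congr rfl fun j _ => by ring
  rw [h]
  calc _ ≤ ‖x‖ * ‖WithLp.toLp 2 (B *ᵥ x.ofLp)‖ := norm_inner_le_norm _ _
    _ ≤ ‖x‖ * (‖B‖ * ‖x‖) := by
      gcongr
      exact Matrix.l2_opNorm_mulVec B x
    _ = ‖B‖ := by rw [hxn]; ring

lemma norm_trace_le (B : Matrix (Fin N) (Fin N) ℂ) : ‖B.trace‖ ≤ N * ‖B‖ := by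
  have h : ∀ i, ‖B i i‖ ≤ ‖B‖ := by
    intro i
    have h1 := norm_realQuadForm_le B (v := EuclideanSpace.single i (1 : ℝ)) (by simp)
    convert h1 using 2
    have h2 : ∀ x : Fin N, (((if x = i then 1 else 0 : ℝ)) : ℂ) = if x = i then 1 else 0 := by
      intro x
      split_ifs <;> simp
    simp [realQuadForm, h2]
  calc ‖B.trace‖ ≤ ∑ i : Fin N, ‖B i i‖ := norm_sum_le _ _
    _ ≤ ∑ _i : Fin N, ‖B‖ := Finset.sum_le_sum fun i _ => h i
    _ = N * ‖B‖ := by simp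

end Resolvent

/-! ### The covariance of the contraction -/

/-- The family of vectors having `u` in slot `p`, `w` in slot `q` and `v` in all other slots. -/
def slotVector {d N : ℕ} (v u w : Fin N → ℝ) (p q k : Fin d) : Fin N → ℝ :=
  if k = p then u else if k = q then w else v

lemma slotVector_perm {d N : ℕ} (v u w : Fin N → ℝ) (σ : Equiv.Perm (Fin d)) (p q k : Fin d) :
    slotVector v u w (σ p) (σ q) (σ k) = slotVector v u w p q k := by
  simp [slotVector]

/-- The symmetric tensor `∑_{p ≠ q} v ⊗ ⋯ ⊗ u ⊗ ⋯ ⊗ w ⊗ ⋯ ⊗ v`, with `u` in slot `p` and `w` in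
slot `q`. It is `d (d - 1)` times the Riesz representative of the linear functional
`T ↦ ⟨u, (T · v^{d-2}) w⟩` on symmetric tensors. -/
noncomputable def slotTensor {d N : ℕ} (v u w : Fin N → ℝ) : SymTensor d N :=
  ⟨WithLp.toLp 2 fun I => ∑ p, ∑ q, if p = q then 0 else ∏ k, slotVector v u w p q k (I k), by
    intro σ I
    simp only [Function.comp_apply]
    rw [← Equiv.sum_comp σ (fun p => ∑ q, if p = q then 0 else
      ∏ k, slotVector v u w p q k (I k))]
    refine Finset.sum_congr rfl fun p _ => ?_
    rw [← Equiv.sum_comp σ (fun q => if σ p = q then 0 else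
      ∏ k, slotVector v u w (σ p) q k (I k))]
    refine Finset.sum_congr rfl fun q _ => ?_
    simp only [EmbeddingLike.apply_eq_iff_eq]
    congr 1
    rw [← Equiv.prod_comp σ (fun k => slotVector v u w (σ p) (σ q) k (I k))]
    simp only [slotVector_perm]⟩

lemma slotTensor_apply {d N : ℕ} (v u w : Fin N → ℝ) (I : Fin d → Fin N) :
    (slotTensor v u w : SymTensor d N).1 I =
      ∑ p, ∑ q, if p = q then 0 else ∏ k, slotVector v u w p q k (I k) := rfl

lemma exists_perm_apply_eq_of_ne {α : Type*} [DecidableEq α] {a b p q : α} (hab : a ≠ b)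
    (hpq : p ≠ q) : ∃ σ : Equiv.Perm α, σ a = p ∧ σ b = q := by
  refine ⟨Equiv.swap a p * Equiv.swap b (Equiv.swap a p q), ?_, ?_⟩
  · have h : a ≠ Equiv.swap a p q := by
      intro h
      apply hpq
      have := congrArg (Equiv.swap a p) h
      simpa using this
    rw [Equiv.Perm.mul_apply, Equiv.swap_apply_of_ne_of_ne hab h, Equiv.swap_apply_left]
  · simp [Equiv.Perm.mul_apply]

lemma sum_multiIndex_eq_sum_contractIndex {n N : ℕ} (f : (Fin (n + 2) → Fin N) → ℝ) :
    ∑ I, f I = ∑ i, ∑ j, ∑ a : Fin n → Fin N, f (contractIndex (d := n + 2) a i j) := by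
  let e : (Fin N × Fin N) × (Fin n → Fin N) ≃ (Fin (n + 2) → Fin N) :=
    { toFun := fun x => contractIndex (d := n + 2) x.2 x.1.1 x.1.2
      invFun := fun I => ((I ⟨n, by omega⟩, I ⟨n + 1, by omega⟩), fun k => I ⟨k, by omega⟩)
      left_inv := by
        rintro ⟨⟨i, j⟩, a⟩
        simp [contractIndex]
      right_inv := by
        intro I
        funext k
        simp only [contractIndex]
        have hk := k.2
        split_ifs with h1 h2
        · rfl
        · congr 1
          exact Fin.ext h2.symm
        · congr 1
          apply Fin.ext
          simp only [Nat.add_sub_cancel] at h1 h2 ⊢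
          omega }
  rw [← e.sum_comp, Fintype.sum_prod_type, Fintype.sum_prod_type]
  rfl

lemma contractIndex_castSucc_castSucc {n N : ℕ} (a : Fin n → Fin N) (i j : Fin N) (k : Fin n) :
    contractIndex (d := n + 2) a i j k.castSucc.castSucc = a k := by
  simp [contractIndex]

lemma contractIndex_castSucc_last {n N : ℕ} (a : Fin n → Fin N) (i j : Fin N) :
    contractIndex (d := n + 2) a i j (Fin.last n).castSucc = i := by
  simp [contractIndex]

lemma contractIndex_last {n N : ℕ} (a : Fin n → Fin N) (i j : Fin N) :
    contractIndex (d := n + 2) a i j (Fin.last (n + 1)) = j := by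
  simp [contractIndex]

lemma contractMatrix_apply {n N : ℕ} (T : SymTensor (n + 2) N) (v : EuclideanSpace ℝ (Fin N))
    (i j : Fin N) :
    contractMatrix T v i j =
      ∑ a : Fin n → Fin N, T.1 (contractIndex (d := n + 2) a i j) * ∏ k, v (a k) := rfl

/-- Up to the factor `(n + 2) (n + 1)`, the slot tensor represents an entry of the quadratic form
of the contraction: by symmetry each of its `(n + 2) (n + 1)` terms has the same inner product
with a symmetric tensor. -/
lemma inner_slotTensor {n N : ℕ} (T : SymTensor (n + 2) N) (v : EuclideanSpace ℝ (Fin N))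
    (u w : Fin N → ℝ) :
    inner ℝ T (slotTensor v u w) =
      ((n : ℝ) + 2) * (n + 1) * ∑ i, ∑ j, u i * w j * contractMatrix T v i j := by
  have key : ∀ p q : Fin (n + 2), p ≠ q →
      ∑ I, T.1 I * ∏ k, slotVector v u w p q k (I k) =
        ∑ i, ∑ j, u i * w j * contractMatrix T v i j := by
    intro p q hpq
    have hab : (Fin.last n).castSucc ≠ Fin.last (n + 1) := (Fin.castSucc_lt_last _).ne
    obtain ⟨σ, rfl, rfl⟩ := exists_perm_apply_eq_of_ne hab hpq
    rw [← Equiv.sum_comp (Equiv.arrowCongr σ (Equiv.refl (Fin N))),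
      sum_multiIndex_eq_sum_contractIndex]
    refine Finset.sum_congr rfl fun i _ => Finset.sum_congr rfl fun j _ => ?_
    rw [contractMatrix_apply, Finset.mul_sum]
    refine Finset.sum_congr rfl fun a _ => ?_
    have h1 : T.1 ((Equiv.arrowCongr σ (Equiv.refl (Fin N))) (contractIndex (d := n + 2) a i j)) =
        T.1 (contractIndex (d := n + 2) a i j) := T.2 σ⁻¹ (contractIndex (d := n + 2) a i j)
    rw [h1, ← Equiv.prod_comp σ, Fin.prod_univ_castSucc, Fin.prod_univ_castSucc]
    simp only [slotVector_perm, Equiv.arrowCongr_apply, Equiv.coe_refl, Function.comp_apply,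
      Equiv.symm_apply_apply, id_eq, contractIndex_castSucc_castSucc, contractIndex_castSucc_last,
      contractIndex_last]
    have h2 : ∀ k : Fin n, slotVector v u w (Fin.last n).castSucc (Fin.last (n + 1))
        k.castSucc.castSucc = v := by
      intro k
      simp [slotVector, (Fin.castSucc_lt_last _).ne]
    have h3 : slotVector v u w (Fin.last n).castSucc (Fin.last (n + 1)) (Fin.last n).castSucc
        = u := by
      simp [slotVector]
    have h4 : slotVector v u w (Fin.last n).castSucc (Fin.last (n + 1)) (Fin.last (n + 1))
        = w := by
      simp [slotVector, hab.symm]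
    simp only [h2, h3, h4]
    ring
  have h0 : inner ℝ T (slotTensor v u w : SymTensor (n + 2) N) =
      ∑ I, T.1 I * (slotTensor v u w : SymTensor (n + 2) N).1 I := by
    rw [Submodule.coe_inner, PiLp.inner_apply]
    refine Finset.sum_congr rfl fun I _ => ?_
    simp [mul_comm]
  rw [h0]
  simp only [slotTensor_apply, Finset.mul_sum]
  rw [Finset.sum_comm]
  have h1 : ∀ p : Fin (n + 2), ∑ I, ∑ q, T.1 I * (if p = q then 0 else
      ∏ k, slotVector v u w p q k (I k)) =
        ((n : ℝ) + 1) * ∑ i, ∑ j, u i * w j * contractMatrix T v i j := by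
    intro p
    rw [Finset.sum_comm]
    have h2 : ∀ q : Fin (n + 2), ∑ I, T.1 I * (if p = q then 0 else
        ∏ k, slotVector v u w p q k (I k)) =
        (if p = q then 0 else 1) * ∑ i, ∑ j, u i * w j * contractMatrix T v i j := by
      intro q
      split_ifs with h
      · simp
      · rw [key p q h, one_mul]
    rw [Finset.sum_congr rfl fun q _ => h2 q, ← Finset.sum_mul]
    congr 1
    have h3 : ∀ q : Fin (n + 2), (if p = q then (0 : ℝ) else 1) = 1 - if p = q then 1 else 0 := by
      intro q
      split_ifs <;> simp
    simp only [h3, Finset.sum_sub_distrib, Finset.sum_ite_eq, Finset.mem_univ, if_true]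
    simp
    ring
  rw [Finset.sum_congr rfl fun p _ => h1 p]
  simp only [Finset.sum_const, Finset.card_univ, Fintype.card_fin, nsmul_eq_mul, Finset.mul_sum]
  push_cast
  refine Finset.sum_congr rfl fun p _ => Finset.sum_congr rfl fun p _ => by ring

/-- Contracting the slot tensor with `v` again gives `u ⊗ w + w ⊗ u` and a perturbation that only
involves the direction `v`. -/
lemma contractMatrix_slotTensor {n N : ℕ} (v : EuclideanSpace ℝ (Fin N)) (hv : ‖v‖ = 1)
    (u w : Fin N → ℝ) (i j : Fin N) :
    contractMatrix (slotTensor v u w : SymTensor (n + 2) N) v i j =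
      u i * w j + w i * u j
      + n * ((∑ b, w b * v b) * (u i * v j + v i * u j) +
          (∑ b, u b * v b) * (w i * v j + v i * w j))
      + n * (n - 1) * ((∑ b, u b * v b) * (∑ b, w b * v b) * (v i * v j)) := by
  have hvv : ∑ b, v b * v b = 1 := by
    have := EuclideanSpace.real_norm_sq_eq v
    rw [hv] at this
    simp only [← pow_two]
    linarith
  set U := ∑ b, u b * v b
  set V := ∑ b, w b * v b
  have key : ∀ p q : Fin (n + 2), ∑ a : Fin n → Fin N,
      (∏ k, slotVector v u w p q k (contractIndex (d := n + 2) a i j k)) * ∏ k, v (a k) =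
      (∏ k : Fin n, ∑ b, slotVector v u w p q k.castSucc.castSucc b * v b) *
        slotVector v u w p q (Fin.last n).castSucc i *
          slotVector v u w p q (Fin.last (n + 1)) j := by
    intro p q
    rw [Finset.prod_univ_sum, Fintype.piFinset_univ, Finset.sum_mul, Finset.sum_mul]
    refine Finset.sum_congr rfl fun a _ => ?_
    rw [Fin.prod_univ_castSucc, Fin.prod_univ_castSucc]
    simp only [contractIndex_castSucc_castSucc, contractIndex_castSucc_last, contractIndex_last,
      Finset.prod_mul_distrib]
    ring
  have h0 : contractMatrix (slotTensor v u w : SymTensor (n + 2) N) v i j =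
      ∑ p : Fin (n + 2), ∑ q : Fin (n + 2), if p = q then 0 else
      (∏ k : Fin n, ∑ b, slotVector v u w p q k.castSucc.castSucc b * v b) *
        slotVector v u w p q (Fin.last n).castSucc i *
          slotVector v u w p q (Fin.last (n + 1)) j := by
    rw [contractMatrix_apply]
    simp only [slotTensor_apply, Finset.sum_mul]
    rw [Finset.sum_comm]
    refine Finset.sum_congr rfl fun p _ => ?_
    rw [Finset.sum_comm]
    refine Finset.sum_congr rfl fun q _ => ?_
    split_ifs with h
    · simp
    · exact key p q
  have hne : ∀ k : Fin n, k.castSucc ≠ Fin.last n := fun k => (Fin.castSucc_lt_last k).ne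
  have hne2 : ∀ k : Fin (n + 1), k.castSucc ≠ Fin.last (n + 1) := fun k =>
    (Fin.castSucc_lt_last k).ne
  have hslot : ∀ p q k : Fin (n + 2), ∑ b, slotVector v u w p q k b * v b =
      if k = p then U else if k = q then V else 1 := by
    intro p q k
    unfold slotVector
    split_ifs
    · rfl
    · rfl
    · exact hvv
  have hpq : ∀ p q : Fin n, p ≠ q →
      (∏ k : Fin n, if k = p then U else if k = q then V else 1) = U * V := by
    intro p q h
    rw [Fintype.prod_eq_mul p q h]
    · simp [h.symm]
    · rintro k ⟨h1, h2⟩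
      simp [h1, h2]
  have hcount : ∑ p : Fin n, ∑ q : Fin n, (if p = q then (0 : ℝ) else 1) = n * (n - 1) := by
    have h3 : ∀ p q : Fin n, (if p = q then (0 : ℝ) else 1) = 1 - if p = q then 1 else 0 := by
      intro p q
      split_ifs <;> simp
    simp only [h3, Finset.sum_sub_distrib, Finset.sum_ite_eq, Finset.mem_univ, if_true]
    simp
    ring
  rw [h0]
  simp only [hslot]
  simp only [Fin.sum_univ_castSucc, slotVector, Fin.castSucc_inj, hne, hne2,
    (hne _).symm, (hne2 _).symm, if_true, if_false, Finset.prod_ite_eq', Finset.mem_univ,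
    Finset.prod_const_one]
  have h5 : ∑ p : Fin n, ∑ q : Fin n, (if p = q then (0 : ℝ) else
      (∏ k : Fin n, if k = p then U else if k = q then V else 1) * v i * v j) =
      n * (n - 1) * (U * V * (v i * v j)) := by
    rw [← hcount, Finset.sum_mul]
    refine Finset.sum_congr rfl fun p _ => ?_
    rw [Finset.sum_mul]
    refine Finset.sum_congr rfl fun q _ => ?_
    split_ifs with h
    · simp
    · rw [hpq p q h]; ring
  simp only [Finset.sum_add_distrib, h5, Finset.sum_const, Finset.card_univ, Fintype.card_fin,
    nsmul_eq_mul]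
  ring

/-! ### Gaussian integration by parts -/

section Stein

variable {V : Type*} [NormedAddCommGroup V] [InnerProductSpace ℝ V]

lemma hasLineDerivAt_exp_neg_norm_sq (x h : V) :
    HasLineDerivAt ℝ (fun x : V => (Real.exp (-(1 / 2) * ‖x‖ ^ 2) : ℂ))
      (-((inner ℝ x h * Real.exp (-(1 / 2) * ‖x‖ ^ 2) : ℝ) : ℂ)) x h := by
  have h1 : ∀ t : ℝ, ‖x + t • h‖ ^ 2 = ‖x‖ ^ 2 + 2 * (t * inner ℝ x h) + t ^ 2 * ‖h‖ ^ 2 := by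
    intro t
    rw [norm_add_sq_real, inner_smul_right, norm_smul, mul_pow, Real.norm_eq_abs, sq_abs]
  have h2 : HasDerivAt (fun t : ℝ => Real.exp (-(1 / 2) * ‖x + t • h‖ ^ 2))
      (-(inner ℝ x h * Real.exp (-(1 / 2) * ‖x‖ ^ 2))) 0 := by
    simp only [h1]
    have h3 : HasDerivAt (fun t : ℝ =>
        -(1 / 2) * (‖x‖ ^ 2 + 2 * (t * inner ℝ x h) + t ^ 2 * ‖h‖ ^ 2))
        (-(1 / 2) * (2 * (1 * inner ℝ x h) + ((2 : ℕ) * (0 : ℝ) ^ (2 - 1) * 1) * ‖h‖ ^ 2)) 0 :=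
      ((((hasDerivAt_id (0 : ℝ)).mul_const (inner ℝ x h)).const_mul 2).const_add _ |>.add
        (((hasDerivAt_id (0 : ℝ)).pow 2).mul_const _)).const_mul _
    have h4 := h3.exp
    convert h4 using 1
    simp
    ring
  have h5 := h2.ofReal_comp
  push_cast at h5 ⊢
  exact_mod_cast h5

variable [FiniteDimensional ℝ V] [MeasurableSpace V] [BorelSpace V]

lemma integrable_exp_neg_mul_norm_sq {b : ℝ} (hb : 0 < b) :
    Integrable fun x : V => Real.exp (-b * ‖x‖ ^ 2) := by
  have h := (GaussianFourier.integrable_cexp_neg_mul_sq_norm_add (V := V) (b := (b : ℂ))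
    (by simpa using hb) 0 0).re
  refine h.congr (Eventually.of_forall fun x => ?_)
  simp only [zero_mul, add_zero, RCLike.re_to_complex]
  rw [← Complex.ofReal_pow, ← Complex.ofReal_neg, ← Complex.ofReal_mul, Complex.exp_ofReal_re]

lemma integrable_norm_mul_exp_neg_norm_sq :
    Integrable fun x : V => ‖x‖ * Real.exp (-(1 / 2) * ‖x‖ ^ 2) := by
  refine (integrable_exp_neg_mul_norm_sq (V := V) (b := 1 / 4) (by norm_num)).mono'
    (Continuous.aestronglyMeasurable (by fun_prop)) (Eventually.of_forall fun x => ?_)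
  rw [Real.norm_of_nonneg (by positivity)]
  have h1 : ‖x‖ ≤ Real.exp (1 / 4 * ‖x‖ ^ 2) := by
    have := Real.add_one_le_exp (1 / 4 * ‖x‖ ^ 2)
    nlinarith [sq_nonneg (‖x‖ - 2)]
  calc ‖x‖ * Real.exp (-(1 / 2) * ‖x‖ ^ 2)
      ≤ Real.exp (1 / 4 * ‖x‖ ^ 2) * Real.exp (-(1 / 2) * ‖x‖ ^ 2) := by gcongr
    _ = Real.exp (-(1 / 4) * ‖x‖ ^ 2) := by rw [← Real.exp_add]; ring_nf

lemma integrable_bounded_mul {f : V → ℂ} (hf : Continuous f) {C : ℝ} (hC : ∀ x, ‖f x‖ ≤ C)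
    {g : V → ℝ} (hg : Integrable g) : Integrable fun x => f x * (g x : ℂ) :=
  hg.ofReal.bdd_mul hf.aestronglyMeasurable (Eventually.of_forall hC)

lemma integrable_inner_mul_exp (h : V) :
    Integrable fun x : V => inner ℝ x h * Real.exp (-(1 / 2) * ‖x‖ ^ 2) := by
  refine (integrable_norm_mul_exp_neg_norm_sq.mul_const ‖h‖).mono'
    (Continuous.aestronglyMeasurable (by fun_prop)) (Eventually.of_forall fun x => ?_)
  rw [norm_mul, Real.norm_of_nonneg (Real.exp_pos _).le]
  calc _ ≤ ‖x‖ * ‖h‖ * Real.exp (-(1 / 2) * ‖x‖ ^ 2) := by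
        gcongr
        exact norm_inner_le_norm x h
    _ = _ := by ring

lemma integral_withDensity_exp_neg_norm_sq {c : ℝ} (hc : 0 ≤ c) (f : V → ℂ) :
    ∫ x, f x ∂(volume.withDensity fun x : V =>
      ENNReal.ofReal (c * Real.exp (-(1 / 2) * ‖x‖ ^ 2))) =
      c * ∫ x, f x * (Real.exp (-(1 / 2) * ‖x‖ ^ 2) : ℂ) := by
  rw [integral_withDensity_eq_integral_toReal_smul
    (Measurable.ennreal_ofReal (Continuous.measurable (by fun_prop)))
    (Eventually.of_forall fun x => ENNReal.ofReal_lt_top), ← integral_const_mul]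
  refine integral_congr_ae (Eventually.of_forall fun x => ?_)
  simp only []
  rw [ENNReal.toReal_ofReal (by positivity), Complex.real_smul]
  push_cast
  ring

lemma integrable_withDensity_exp_neg_norm_sq {c : ℝ} (hc : 0 ≤ c) {f : V → ℂ}
    (hf : Integrable fun x => f x * (Real.exp (-(1 / 2) * ‖x‖ ^ 2) : ℂ)) :
    Integrable f (volume.withDensity fun x : V =>
      ENNReal.ofReal (c * Real.exp (-(1 / 2) * ‖x‖ ^ 2))) := by
  rw [integrable_withDensity_iff_integrable_smul'
    (Measurable.ennreal_ofReal (Continuous.measurable (by fun_prop)))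
    (Eventually.of_forall fun x => ENNReal.ofReal_lt_top)]
  refine (hf.const_mul (c : ℂ)).congr (Eventually.of_forall fun x => ?_)
  simp only []
  rw [ENNReal.toReal_ofReal (by positivity), Complex.real_smul]
  push_cast
  ring

/-- **Stein's identity** for the Gaussian measure with density proportional to
`exp (-‖x‖² / 2)`. -/
theorem integral_inner_mul_eq_integral_lineDeriv {c : ℝ} (hc : 0 ≤ c) {f f' : V → ℂ} {h : V}
    (hf : Continuous f) (hf' : Continuous f') {C C' : ℝ} (hC : ∀ x, ‖f x‖ ≤ C)
    (hC' : ∀ x, ‖f' x‖ ≤ C') (hderiv : ∀ x, HasLineDerivAt ℝ f (f' x) x h) :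
    ∫ x, (inner ℝ x h : ℂ) * f x ∂(volume.withDensity fun x : V =>
      ENNReal.ofReal (c * Real.exp (-(1 / 2) * ‖x‖ ^ 2))) =
    ∫ x, f' x ∂(volume.withDensity fun x : V =>
      ENNReal.ofReal (c * Real.exp (-(1 / 2) * ‖x‖ ^ 2))) := by
  have hexp := integrable_exp_neg_mul_norm_sq (V := V) (b := 1 / 2) (by norm_num)
  have hinner := integrable_inner_mul_exp h
  rw [integral_withDensity_exp_neg_norm_sq hc, integral_withDensity_exp_neg_norm_sq hc]
  congr 1
  have key := integral_bilinear_hasLineDerivAt_right_eq_neg_left_of_integrable (μ := volume)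
    (B := ContinuousLinearMap.mul ℝ ℂ) (f := f) (f' := f') (v := h)
    (g := fun x : V => (Real.exp (-(1 / 2) * ‖x‖ ^ 2) : ℂ))
    (g' := fun x : V => -((inner ℝ x h * Real.exp (-(1 / 2) * ‖x‖ ^ 2) : ℝ) : ℂ))
    (integrable_bounded_mul hf' hC' hexp)
    (by
      simp only [ContinuousLinearMap.mul_apply', mul_neg]
      exact (integrable_bounded_mul hf hC hinner).neg)
    (integrable_bounded_mul hf hC hexp)
    (fun x _ => hderiv x) (fun x _ => hasLineDerivAt_exp_neg_norm_sq x h)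
  simp only [ContinuousLinearMap.mul_apply', mul_neg, integral_neg, neg_inj] at key
  rw [← key]
  refine integral_congr_ae (Eventually.of_forall fun x => ?_)
  simp only []
  push_cast
  ring

end Stein

/-! ### Contractions of resolvents against the covariance -/

section Contraction

open scoped Matrix Matrix.Norms.L2Operator

variable {n N : ℕ} {v : EuclideanSpace ℝ (Fin N)}

/-- The contraction of the slot tensor of two standard basis vectors. Up to the factor
`(n + 2) (n + 1)` its entries are the covariances of the entry `(i, j)` of the Gaussian matrix
`T · vⁿ` with the other entries. -/
noncomputable def covarianceMatrix (n : ℕ) (v : EuclideanSpace ℝ (Fin N)) (i j : Fin N) :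
    Matrix (Fin N) (Fin N) ℝ :=
  contractMatrix (slotTensor v (Pi.single i 1) (Pi.single j 1) : SymTensor (n + 2) N) v

lemma inner_slotTensor_single (T : SymTensor (n + 2) N) (v : EuclideanSpace ℝ (Fin N))
    (i j : Fin N) :
    inner ℝ T (slotTensor v (Pi.single i 1) (Pi.single j 1)) =
      ((n : ℝ) + 2) * (n + 1) * contractMatrix T v i j := by
  rw [inner_slotTensor]
  simp [Pi.single_apply]

lemma isHermitian_covarianceMatrix (i j : Fin N) : (covarianceMatrix n v i j).IsHermitian :=
  contractMatrix_isHermitian (by omega) _ _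

lemma map_covarianceMatrix (hv : ‖v‖ = 1) (i j : Fin N) :
    (covarianceMatrix n v i j).map Complex.ofReal =
      Matrix.vecMulVec (Pi.single i 1) (Pi.single j 1) +
      Matrix.vecMulVec (Pi.single j 1) (Pi.single i 1) +
      (n : ℂ) • ((v j : ℂ) • (Matrix.vecMulVec (Pi.single i 1) (fun l => (v l : ℂ)) +
          Matrix.vecMulVec (fun l => (v l : ℂ)) (Pi.single i 1)) +
        (v i : ℂ) • (Matrix.vecMulVec (Pi.single j 1) (fun l => (v l : ℂ)) +
          Matrix.vecMulVec (fun l => (v l : ℂ)) (Pi.single j 1))) +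
      ((n : ℂ) * (n - 1) * (v i * v j)) •
        Matrix.vecMulVec (fun l => (v l : ℂ)) (fun l => (v l : ℂ)) := by
  have hs : ∀ i k : Fin N, ((Pi.single i (1 : ℝ) : Fin N → ℝ) k : ℂ) =
      (Pi.single i (1 : ℂ) : Fin N → ℂ) k := by
    intro i k
    simp only [Pi.single_apply]
    split_ifs <;> simp
  have hsum : ∀ i : Fin N, ∑ b, (Pi.single i (1 : ℝ) : Fin N → ℝ) b * v b = v i := by
    intro i
    simp [Pi.single_apply]
  ext k l
  rw [Matrix.map_apply, covarianceMatrix, contractMatrix_slotTensor v hv, hsum, hsum]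
  push_cast
  simp only [hs, Matrix.add_apply, Matrix.smul_apply, Matrix.vecMulVec_apply, smul_eq_mul]
  ring

lemma mul_covarianceMatrix_mul_apply (hv : ‖v‖ = 1) (A B : Matrix (Fin N) (Fin N) ℂ)
    (i j p q : Fin N) :
    (A * (covarianceMatrix n v i j).map Complex.ofReal * B) p q =
      A p i * B j q + A p j * B i q +
      n * (v j * (A p i * ((fun l => (v l : ℂ)) ᵥ* B) q + (A *ᵥ fun l => (v l : ℂ)) p * B i q) +
        v i * (A p j * ((fun l => (v l : ℂ)) ᵥ* B) q + (A *ᵥ fun l => (v l : ℂ)) p * B j q)) +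
      n * (n - 1) * (v i * v j) *
        ((A *ᵥ fun l => (v l : ℂ)) p * ((fun l => (v l : ℂ)) ᵥ* B) q) := by
  rw [map_covarianceMatrix hv]
  simp only [mul_add, add_mul, mul_smul_comm, smul_mul_assoc, Matrix.mul_vecMulVec,
    Matrix.vecMulVec_mul, Matrix.mulVec_single_one, Matrix.single_one_vecMul, Matrix.add_apply,
    Matrix.smul_apply, Matrix.vecMulVec_apply, smul_eq_mul, Matrix.col_apply, Matrix.row_apply,
    smul_add]

lemma realQuadForm_eq_sum_mulVec (A : Matrix (Fin N) (Fin N) ℂ) :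
    realQuadForm A v = ∑ i, (v i : ℂ) * (A *ᵥ fun l => (v l : ℂ)) i := by
  simp only [realQuadForm, Matrix.mulVec, dotProduct, Finset.mul_sum, mul_assoc]

lemma realQuadForm_mul {A B : Matrix (Fin N) (Fin N) ℂ} (hA : Aᵀ = A) :
    realQuadForm (A * B) v =
      ∑ i, (A *ᵥ fun l => (v l : ℂ)) i * (B *ᵥ fun l => (v l : ℂ)) i := by
  rw [realQuadForm_eq_sum_mulVec, ← Matrix.mulVec_mulVec]
  change (fun l => (v l : ℂ)) ⬝ᵥ (A *ᵥ (B *ᵥ fun l => (v l : ℂ))) = _ ⬝ᵥ _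
  rw [Matrix.dotProduct_mulVec, ← Matrix.mulVec_transpose, hA]

lemma vecMul_eq_mulVec {A : Matrix (Fin N) (Fin N) ℂ} (hA : Aᵀ = A) (x : Fin N → ℂ) :
    x ᵥ* A = A *ᵥ x := by
  rw [← Matrix.mulVec_transpose, hA]

/-- The divergence of the resolvent along the covariance: the leading term is the square of the
trace. -/
lemma sum_mul_covarianceMatrix_mul (hv : ‖v‖ = 1) {A : Matrix (Fin N) (Fin N) ℂ} (hA : Aᵀ = A) :
    ∑ i, ∑ j, (A * (covarianceMatrix n v i j).map Complex.ofReal * A) j i =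
      A.trace ^ 2 + ((A * A).trace + 2 * n * (realQuadForm A v * A.trace + realQuadForm (A * A) v) +
      n * (n - 1) * realQuadForm A v ^ 2) := by
  have hsym : ∀ i j, A j i = A i j := fun i j => by
    conv_lhs => rw [← hA]
    rfl
  simp only [mul_covarianceMatrix_mul_apply hv, vecMul_eq_mulVec hA]
  rw [realQuadForm_mul hA, realQuadForm_eq_sum_mulVec]
  set a := A *ᵥ fun l => (v l : ℂ) with ha
  have hai : ∀ i, a i = ∑ j, A j i * v j := by
    intro i
    simp only [ha, Matrix.mulVec, dotProduct]
    exact Finset.sum_congr rfl fun j _ => by rw [hsym i j]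
  have h1 : A.trace ^ 2 = ∑ i, ∑ j, A j j * A i i := by
    rw [pow_two, Matrix.trace, Finset.sum_mul_sum, Finset.sum_comm]
    rfl
  have h2 : (A * A).trace = ∑ i, ∑ j, A j i * A j i := by
    simp only [Matrix.trace, Matrix.diag, Matrix.mul_apply]
    exact Finset.sum_congr rfl fun i _ => Finset.sum_congr rfl fun j _ => by rw [hsym i j]
  have h3 : (∑ i, (v i : ℂ) * a i) * A.trace = ∑ i, ∑ j, (v j : ℂ) * (a j * A i i) := by
    rw [Matrix.trace, Finset.sum_mul_sum, Finset.sum_comm]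
    exact Finset.sum_congr rfl fun i _ => Finset.sum_congr rfl fun j _ => by
      rw [Matrix.diag_apply]; ring
  have h3' : (∑ i, (v i : ℂ) * a i) * A.trace = ∑ i, ∑ j, (v i : ℂ) * (A j j * a i) := by
    rw [Matrix.trace, Finset.sum_mul_sum]
    exact Finset.sum_congr rfl fun i _ => Finset.sum_congr rfl fun j _ => by
      rw [Matrix.diag_apply]; ring
  have h4 : ∑ i, a i * a i = ∑ i, ∑ j, (v j : ℂ) * (A j i * a i) := by
    refine Finset.sum_congr rfl fun i _ => ?_
    nth_rewrite 1 [hai i]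
    rw [Finset.sum_mul]
    exact Finset.sum_congr rfl fun j _ => by ring
  have h4' : ∑ i, a i * a i = ∑ i, ∑ j, (v i : ℂ) * (a j * A j i) := by
    rw [h4, Finset.sum_comm]
    exact Finset.sum_congr rfl fun i _ => Finset.sum_congr rfl fun j _ => by rw [hsym i j]; ring
  have h5 : (∑ i, (v i : ℂ) * a i) ^ 2 = ∑ i, ∑ j, (v i : ℂ) * v j * (a j * a i) := by
    rw [pow_two, Finset.sum_mul_sum]
    exact Finset.sum_congr rfl fun i _ => Finset.sum_congr rfl fun j _ => by ring
  have h6 : (2 : ℂ) * n * ((∑ i, (v i : ℂ) * a i) * A.trace + ∑ i, a i * a i) =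
      n * (((∑ i, (v i : ℂ) * a i) * A.trace + (∑ i, (v i : ℂ) * a i) * A.trace) +
        (∑ i, a i * a i + ∑ i, a i * a i)) := by ring
  rw [h6]
  nth_rewrite 1 [h3]
  nth_rewrite 1 [h3']
  nth_rewrite 1 [h4]
  nth_rewrite 1 [h4']
  rw [h1, h2, h5]
  simp only [Finset.mul_sum, mul_add, ← Finset.sum_add_distrib]
  exact Finset.sum_congr rfl fun i _ => Finset.sum_congr rfl fun j _ => by ring

lemma trace_mul_covarianceMatrix (hv : ‖v‖ = 1) {H : Matrix (Fin N) (Fin N) ℂ} (hH : Hᵀ = H)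
    (i j : Fin N) :
    (H * (covarianceMatrix n v i j).map Complex.ofReal).trace =
      2 * H j i + 2 * n * (v j * (H *ᵥ fun l => (v l : ℂ)) i + v i * (H *ᵥ fun l => (v l : ℂ)) j) +
      n * (n - 1) * (v i * v j) * realQuadForm H v := by
  have hsym : ∀ i j, H j i = H i j := fun i j => by
    conv_lhs => rw [← hH]
    rfl
  have hcol : ∀ i, (H *ᵥ fun l => (v l : ℂ)) i = ∑ p, H p i * v p := by
    intro i
    simp only [Matrix.mulVec, dotProduct]
    exact Finset.sum_congr rfl fun p _ => by rw [hsym i p]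
  have htrace : (H * (covarianceMatrix n v i j).map Complex.ofReal).trace =
      ∑ p, (H * (covarianceMatrix n v i j).map Complex.ofReal *
        (1 : Matrix (Fin N) (Fin N) ℂ)) p p := by
    rw [mul_one]
    rfl
  rw [htrace]
  simp only [mul_covarianceMatrix_mul_apply hv, Matrix.vecMul_one, Finset.sum_add_distrib,
    ← Finset.mul_sum, Matrix.one_apply, mul_ite, mul_one, mul_zero,
    Finset.sum_ite_eq, Finset.mem_univ, if_true, ← hcol]
  rw [realQuadForm_eq_sum_mulVec, hsym j i, Finset.sum_congr rfl fun p _ => mul_comm _ _]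
  ring

lemma sum_mul_trace_mul_covarianceMatrix (hv : ‖v‖ = 1) {A H : Matrix (Fin N) (Fin N) ℂ}
    (hA : Aᵀ = A) (hH : Hᵀ = H) :
    ∑ i, ∑ j, A j i * (H * (covarianceMatrix n v i j).map Complex.ofReal).trace =
      2 * (A * H).trace + 4 * n * realQuadForm (A * H) v +
        n * (n - 1) * (realQuadForm A v * realQuadForm H v) := by
  have hsymA : ∀ i j, A j i = A i j := fun i j => by
    conv_lhs => rw [← hA]
    rfl
  simp only [trace_mul_covarianceMatrix hv hH]
  rw [realQuadForm_mul hA]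
  set a := A *ᵥ fun l => (v l : ℂ) with ha
  set h := H *ᵥ fun l => (v l : ℂ)
  have hai : ∀ i, a i = ∑ j, A j i * v j := by
    intro i
    simp only [ha, Matrix.mulVec, dotProduct]
    exact Finset.sum_congr rfl fun j _ => by rw [hsymA i j]
  have h1 : (A * H).trace = ∑ i, ∑ j, A j i * H j i := by
    simp only [Matrix.trace, Matrix.diag, Matrix.mul_apply]
    exact Finset.sum_congr rfl fun i _ => Finset.sum_congr rfl fun j _ => by rw [hsymA i j]
  have h2 : ∑ i, a i * h i = ∑ i, ∑ j, A j i * (v j * h i) := by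
    refine Finset.sum_congr rfl fun i _ => ?_
    rw [hai i, Finset.sum_mul]
    exact Finset.sum_congr rfl fun j _ => by ring
  have h2' : ∑ i, a i * h i = ∑ i, ∑ j, A j i * (v i * h j) := by
    rw [h2, Finset.sum_comm]
    exact Finset.sum_congr rfl fun i _ => Finset.sum_congr rfl fun j _ => by rw [hsymA i j]
  have h3 : realQuadForm A v = ∑ i, ∑ j, A j i * (v i * v j) := by
    rw [realQuadForm]
    exact Finset.sum_congr rfl fun i _ => Finset.sum_congr rfl fun j _ => by rw [hsymA i j]; ring
  have h6 : (4 : ℂ) * n * ∑ i, a i * h i =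
      2 * n * (∑ i, a i * h i + ∑ i, a i * h i) := by ring
  rw [h6]
  nth_rewrite 1 [h2]
  nth_rewrite 1 [h2']
  rw [h1, h3, Finset.sum_mul]
  simp only [Finset.sum_mul, Finset.mul_sum, mul_add, ← Finset.sum_add_distrib]
  exact Finset.sum_congr rfl fun i _ => Finset.sum_congr rfl fun j _ => by ring

end Contraction

/-! ### The approximate self-consistent equation -/

section SelfConsistent

open scoped Matrix Matrix.Norms.L2Operator ComplexConjugate

/-- The Stieltjes transform `(1 / N) tr (A - z)⁻¹` of the empirical spectral measure. -/
noncomputable def empiricalStieltjes {N : ℕ} (A : Matrix (Fin N) (Fin N) ℝ) (z : ℂ) : ℂ :=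
  (N : ℂ)⁻¹ * (resolventMatrix A z).trace

/-- The defect `s m² + z m + 1` of `m` in the quadratic equation satisfied by the Stieltjes
transform of the semicircle law of variance `s`. -/
def semicircleDefect (s : ℝ) (z m : ℂ) : ℂ := s * m ^ 2 + z * m + 1

/-- The variance `1 / ((n + 2) (n + 1))` of the off-diagonal entries of `T · vⁿ` away from the
direction `v`. -/
noncomputable def entryVariance (n : ℕ) : ℝ := (((n : ℝ) + 2) * (n + 1))⁻¹

lemma entryVariance_pos (n : ℕ) : 0 < entryVariance n := by
  unfold entryVariance
  positivity

variable {n N : ℕ} {v : EuclideanSpace ℝ (Fin N)} {z : ℂ}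

lemma isHermitian_scaledContraction (T : SymTensor (n + 2) N) (v : EuclideanSpace ℝ (Fin N)) :
    (scaledContraction T v).IsHermitian :=
  scaledContraction_isHermitian (by omega) T v

lemma scaledContraction_add_smul (T S : SymTensor (n + 2) N) (t : ℝ) :
    scaledContraction (T + t • S) v = scaledContraction T v + t • scaledContraction S v := by
  ext i j
  simp only [scaledContraction, Matrix.smul_apply, Matrix.add_apply, contractMatrix_apply,
    smul_eq_mul, Submodule.coe_add, Submodule.coe_smul, PiLp.add_apply, PiLp.smul_apply, add_mul,
    Finset.sum_add_distrib, mul_add, Finset.mul_sum]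
  congr 1
  exact Finset.sum_congr rfl fun a _ => by ring

lemma continuous_scaledContraction :
    Continuous fun T : SymTensor (n + 2) N => scaledContraction T v := by
  refine continuous_matrix fun i j => ?_
  simp only [scaledContraction, Matrix.smul_apply, contractMatrix_apply]
  fun_prop

lemma continuous_resolventMatrix_scaledContraction (hz : z.im ≠ 0) :
    Continuous fun T : SymTensor (n + 2) N => resolventMatrix (scaledContraction T v) z :=
  continuous_resolventMatrix continuous_scaledContraction
    (fun T => isHermitian_scaledContraction T v) hz

lemma continuous_empiricalStieltjes (hz : z.im ≠ 0) :
    Continuous fun T : SymTensor (n + 2) N => empiricalStieltjes (scaledContraction T v) z :=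
  continuous_const.mul (continuous_resolventMatrix_scaledContraction hz).matrix_trace

lemma continuous_semicircleDefect (s : ℝ) (z : ℂ) : Continuous (semicircleDefect s z) := by
  unfold semicircleDefect
  fun_prop

lemma norm_empiricalStieltjes_le {A : Matrix (Fin N) (Fin N) ℝ} (hA : A.IsHermitian)
    (hz : z.im ≠ 0) : ‖empiricalStieltjes A z‖ ≤ 1 / |z.im| := by
  rw [empiricalStieltjes, norm_mul, norm_inv, Complex.norm_natCast]
  rcases Nat.eq_zero_or_pos N with rfl | hN
  · simp
  · have hN' : (0 : ℝ) < N := by exact_mod_cast hN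
    rw [inv_mul_le_iff₀ hN']
    refine (norm_trace_le _).trans ?_
    gcongr
    exact norm_resolventMatrix_le hA hz

lemma norm_semicircleDefect_le {s : ℝ} (hs : 0 ≤ s) {m : ℂ} {C : ℝ} (hm : ‖m‖ ≤ C) :
    ‖semicircleDefect s z m‖ ≤ s * C ^ 2 + ‖z‖ * C + 1 := by
  unfold semicircleDefect
  calc _ ≤ ‖(s : ℂ) * m ^ 2‖ + ‖z * m‖ + ‖(1 : ℂ)‖ := norm_add₃_le
    _ ≤ _ := by
      rw [norm_mul, norm_mul, norm_pow, Complex.norm_real, Real.norm_of_nonneg hs, norm_one]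
      gcongr

lemma norm_entry_le (B : Matrix (Fin N) (Fin N) ℂ) (i j : Fin N) : ‖B i j‖ ≤ ‖B‖ := by
  have h1 : B i j = (WithLp.toLp 2 (B *ᵥ (EuclideanSpace.single j (1 : ℂ)).ofLp) :
      EuclideanSpace ℂ (Fin N)) i := by
    simp
  rw [h1]
  refine (PiLp.norm_apply_le _ _).trans ?_
  have h2 := Matrix.l2_opNorm_mulVec B (EuclideanSpace.single j (1 : ℂ))
  simpa using h2

lemma hasLineDerivAt_resolventMatrix (hz : z.im ≠ 0) (T S : SymTensor (n + 2) N) (i j : Fin N) :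
    HasLineDerivAt ℝ (fun T => resolventMatrix (scaledContraction T v) z i j)
      (-(resolventMatrix (scaledContraction T v) z *
        (scaledContraction S v).map Complex.ofReal *
          resolventMatrix (scaledContraction T v) z) i j) T S := by
  have h := hasDerivAt_resolventMatrix (isHermitian_scaledContraction T v)
    (isHermitian_scaledContraction S v) hz i j
  simp only [← scaledContraction_add_smul] at h
  exact h

lemma hasLineDerivAt_empiricalStieltjes (hz : z.im ≠ 0) (T S : SymTensor (n + 2) N) :
    HasLineDerivAt ℝ (fun T => empiricalStieltjes (scaledContraction T v) z)
      (-((N : ℂ)⁻¹ * (resolventMatrix (scaledContraction T v) z *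
        (scaledContraction S v).map Complex.ofReal *
          resolventMatrix (scaledContraction T v) z).trace)) T S := by
  have h : HasDerivAt (fun t : ℝ => (N : ℂ)⁻¹ *
      ∑ i, resolventMatrix (scaledContraction (T + t • S) v) z i i)
      ((N : ℂ)⁻¹ * ∑ i, -(resolventMatrix (scaledContraction T v) z *
        (scaledContraction S v).map Complex.ofReal *
          resolventMatrix (scaledContraction T v) z) i i) 0 :=
    (HasDerivAt.fun_sum fun i _ => hasLineDerivAt_resolventMatrix hz T S i i).const_mul _
  rw [Finset.sum_neg_distrib, mul_neg] at h
  exact h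

lemma hasLineDerivAt_conj_semicircleDefect (s : ℝ) (hz : z.im ≠ 0) (T S : SymTensor (n + 2) N) :
    HasLineDerivAt ℝ
      (fun T => conj (semicircleDefect s z (empiricalStieltjes (scaledContraction T v) z)))
      (conj ((2 * s * empiricalStieltjes (scaledContraction T v) z + z) *
        -((N : ℂ)⁻¹ * (resolventMatrix (scaledContraction T v) z *
          (scaledContraction S v).map Complex.ofReal *
            resolventMatrix (scaledContraction T v) z).trace))) T S := by
  have h : HasDerivAt (fun t : ℝ => empiricalStieltjes (scaledContraction (T + t • S) v) z) _ 0 :=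
    hasLineDerivAt_empiricalStieltjes hz T S
  have h2 := ((((h.pow 2).const_mul (s : ℂ)).add (h.const_mul z)).add_const 1).star
  refine HasDerivAt.congr_deriv h2 ?_
  simp only [zero_smul, add_zero]
  change conj _ = conj _
  congr 1
  push_cast
  ring

/-- The trace of `X (X - z)⁻¹` is determined by the Stieltjes transform. -/
lemma semicircleDefect_mul_eq (hN : N ≠ 0) (s : ℝ) (hz : z.im ≠ 0)
    {A : Matrix (Fin N) (Fin N) ℝ} (hA : A.IsHermitian) :
    semicircleDefect s z (empiricalStieltjes A z) =
      s * empiricalStieltjes A z ^ 2 +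
        (N : ℂ)⁻¹ * ∑ i, ∑ j, (A i j : ℂ) * resolventMatrix A z j i := by
  have hN' : (N : ℂ) ≠ 0 := by exact_mod_cast hN
  have h1 : A.map Complex.ofReal * resolventMatrix A z = 1 + z • resolventMatrix A z := by
    have h := sub_smul_one_mul_resolventMatrix hA hz
    rw [sub_mul, smul_mul_assoc, one_mul, sub_eq_iff_eq_add] at h
    exact h
  have h2 : ∑ i, ∑ j, (A i j : ℂ) * resolventMatrix A z j i =
      (A.map Complex.ofReal * resolventMatrix A z).trace := by
    simp [Matrix.trace, Matrix.mul_apply]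
  rw [h2, h1, Matrix.trace_add, Matrix.trace_smul, Matrix.trace_one, Fintype.card_fin,
    semicircleDefect, empiricalStieltjes, smul_eq_mul]
  field_simp
  ring

/-- The part of the divergence of the resolvent which is of lower order than the squared trace. -/
noncomputable def divergenceError (n : ℕ) (v : EuclideanSpace ℝ (Fin N))
    (G : Matrix (Fin N) (Fin N) ℂ) : ℂ :=
  (G * G).trace + 2 * n * (realQuadForm G v * G.trace + realQuadForm (G * G) v) +
    n * (n - 1) * realQuadForm G v ^ 2

/-- The contraction of the resolvent with the gradient of its conjugate trace. -/
noncomputable def gradientError (n : ℕ) (v : EuclideanSpace ℝ (Fin N))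
    (G : Matrix (Fin N) (Fin N) ℂ) : ℂ :=
  2 * (G * (Gᴴ * Gᴴ)).trace + 4 * n * realQuadForm (G * (Gᴴ * Gᴴ)) v +
    n * (n - 1) * (realQuadForm G v * realQuadForm (Gᴴ * Gᴴ) v)

lemma norm_natCast_mul_sub_one (n : ℕ) : ‖(n : ℂ) * (n - 1)‖ = n * (n - 1) := by
  have h : (0 : ℝ) ≤ n * (n - 1) := by
    rcases Nat.eq_zero_or_pos n with rfl | hn
    · simp
    · have : (1 : ℝ) ≤ n := by exact_mod_cast hn
      nlinarith
  have h2 : (n : ℂ) * (n - 1) = ((n * (n - 1) : ℝ) : ℂ) := by push_cast; ring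
  rw [h2, Complex.norm_real, Real.norm_of_nonneg h]

lemma natCast_mul_sub_one_nonneg (n : ℕ) : (0 : ℝ) ≤ n * (n - 1) := by
  rw [← norm_natCast_mul_sub_one]
  exact norm_nonneg _

lemma norm_divergenceError_le (hv : ‖v‖ = 1) {G : Matrix (Fin N) (Fin N) ℂ} {C : ℝ}
    (hG : ‖G‖ ≤ C) :
    ‖divergenceError n v G‖ ≤ (N + 2 * n * (N + 1) + n * (n - 1)) * C ^ 2 := by
  have hC : 0 ≤ C := (norm_nonneg G).trans hG
  have hGG : ‖G * G‖ ≤ C ^ 2 := by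
    rw [pow_two]
    exact (norm_mul_le G G).trans (mul_le_mul hG hG (norm_nonneg _) hC)
  have hq : ‖realQuadForm G v‖ ≤ C := (norm_realQuadForm_le G hv).trans hG
  have hq2 : ‖realQuadForm (G * G) v‖ ≤ C ^ 2 := (norm_realQuadForm_le _ hv).trans hGG
  have ht : ‖G.trace‖ ≤ N * C := (norm_trace_le G).trans (by gcongr)
  have ht2 : ‖(G * G).trace‖ ≤ N * C ^ 2 := (norm_trace_le _).trans (by gcongr)
  have hn := natCast_mul_sub_one_nonneg n
  calc ‖divergenceError n v G‖
      ≤ ‖(G * G).trace‖ + ‖2 * n * (realQuadForm G v * G.trace + realQuadForm (G * G) v)‖ +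
        ‖n * (n - 1) * realQuadForm G v ^ 2‖ := norm_add₃_le
    _ ≤ N * C ^ 2 + 2 * n * (C * (N * C) + C ^ 2) + n * (n - 1) * C ^ 2 := by
      rw [norm_mul, norm_mul _ (realQuadForm G v ^ 2), norm_natCast_mul_sub_one, norm_mul,
        Complex.norm_natCast, Complex.norm_ofNat, norm_pow]
      gcongr
      refine (norm_add_le _ _).trans ?_
      rw [norm_mul]
      gcongr
    _ = _ := by ring

lemma norm_gradientError_le (hv : ‖v‖ = 1) {G : Matrix (Fin N) (Fin N) ℂ} {C : ℝ}
    (hG : ‖G‖ ≤ C) :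
    ‖gradientError n v G‖ ≤ (2 * N + 4 * n + n * (n - 1)) * C ^ 3 := by
  have hC : 0 ≤ C := (norm_nonneg G).trans hG
  have hG' : ‖Gᴴ‖ ≤ C := by rwa [Matrix.l2_opNorm_conjTranspose]
  have hH : ‖Gᴴ * Gᴴ‖ ≤ C ^ 2 := by
    rw [pow_two]
    exact (norm_mul_le _ _).trans (mul_le_mul hG' hG' (norm_nonneg _) hC)
  have hGH : ‖G * (Gᴴ * Gᴴ)‖ ≤ C ^ 3 := by
    rw [pow_succ' C 2]
    exact (norm_mul_le _ _).trans (mul_le_mul hG hH (norm_nonneg _) hC)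
  have hq : ‖realQuadForm G v‖ ≤ C := (norm_realQuadForm_le G hv).trans hG
  have hq2 : ‖realQuadForm (Gᴴ * Gᴴ) v‖ ≤ C ^ 2 := (norm_realQuadForm_le _ hv).trans hH
  have hq3 : ‖realQuadForm (G * (Gᴴ * Gᴴ)) v‖ ≤ C ^ 3 := (norm_realQuadForm_le _ hv).trans hGH
  have ht : ‖(G * (Gᴴ * Gᴴ)).trace‖ ≤ N * C ^ 3 := (norm_trace_le _).trans (by gcongr)
  have hn := natCast_mul_sub_one_nonneg n
  calc ‖gradientError n v G‖
      ≤ ‖2 * (G * (Gᴴ * Gᴴ)).trace‖ + ‖4 * n * realQuadForm (G * (Gᴴ * Gᴴ)) v‖ +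
        ‖n * (n - 1) * (realQuadForm G v * realQuadForm (Gᴴ * Gᴴ) v)‖ := norm_add₃_le
    _ ≤ 2 * (N * C ^ 3) + 4 * n * C ^ 3 + n * (n - 1) * (C * C ^ 2) := by
      rw [norm_mul, norm_mul (4 * (n : ℂ)), norm_mul _ (realQuadForm G v * _),
        norm_natCast_mul_sub_one, norm_mul (4 : ℂ), norm_mul (realQuadForm G v),
        Complex.norm_natCast, Complex.norm_ofNat, Complex.norm_ofNat]
      gcongr
    _ = _ := by ring

lemma map_scaledContraction_slotTensor (i j : Fin N) :
    (scaledContraction (slotTensor v (Pi.single i 1) (Pi.single j 1) :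
      SymTensor (n + 2) N) v).map Complex.ofReal =
      ((Real.sqrt N)⁻¹ : ℂ) • (covarianceMatrix n v i j).map Complex.ofReal := by
  ext k l
  simp [scaledContraction, covarianceMatrix]

/-- The derivative of `G_ji φ` in the direction of the slot tensor of the basis vectors `i` and
`j`, where `G` is the resolvent and `φ` the conjugate of the defect. -/
noncomputable def steinDerivative (n : ℕ) (v : EuclideanSpace ℝ (Fin N)) (z : ℂ) (i j : Fin N)
    (A : Matrix (Fin N) (Fin N) ℝ) : ℂ :=
  -((Real.sqrt N)⁻¹ : ℂ) *
    ((resolventMatrix A z * (covarianceMatrix n v i j).map Complex.ofReal *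
        resolventMatrix A z) j i *
        conj (semicircleDefect (entryVariance n) z (empiricalStieltjes A z)) +
      resolventMatrix A z j i *
        ((N : ℂ)⁻¹ * conj (2 * entryVariance n * empiricalStieltjes A z + z) *
          ((resolventMatrix A z)ᴴ * (resolventMatrix A z)ᴴ *
            (covarianceMatrix n v i j).map Complex.ofReal).trace))

lemma conj_trace_mul_covarianceMatrix_mul (G : Matrix (Fin N) (Fin N) ℂ) (i j : Fin N) :
    conj (G * (covarianceMatrix n v i j).map Complex.ofReal * G).trace =
      (Gᴴ * Gᴴ * (covarianceMatrix n v i j).map Complex.ofReal).trace := by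
  have hR : ((covarianceMatrix n v i j).map Complex.ofReal)ᴴ =
      (covarianceMatrix n v i j).map Complex.ofReal := by
    ext k l
    have h := congrFun (congrFun (isHermitian_covarianceMatrix (n := n) (v := v) i j) k) l
    simp only [Matrix.conjTranspose_apply, star_trivial] at h
    simp [Matrix.conjTranspose_apply, h]
  change star _ = _
  rw [← Matrix.trace_conjTranspose, Matrix.conjTranspose_mul, Matrix.conjTranspose_mul, hR,
    ← mul_assoc, Matrix.trace_mul_comm, ← mul_assoc]

lemma hasLineDerivAt_stein (hz : z.im ≠ 0) (T : SymTensor (n + 2) N) (i j : Fin N) :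
    HasLineDerivAt ℝ (fun T : SymTensor (n + 2) N =>
      resolventMatrix (scaledContraction T v) z j i *
        conj (semicircleDefect (entryVariance n) z (empiricalStieltjes (scaledContraction T v) z)))
      (steinDerivative n v z i j (scaledContraction T v)) T
      (slotTensor v (Pi.single i 1) (Pi.single j 1)) := by
  have h := HasDerivAt.mul
    (hasLineDerivAt_resolventMatrix (v := v) hz T
      (slotTensor v (Pi.single i 1) (Pi.single j 1)) j i)
    (hasLineDerivAt_conj_semicircleDefect (v := v) (entryVariance n) hz T
      (slotTensor v (Pi.single i 1) (Pi.single j 1)))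
  refine HasDerivAt.congr_deriv h ?_
  simp only [zero_smul, add_zero, map_scaledContraction_slotTensor, mul_smul_comm, smul_mul_assoc,
    Matrix.trace_smul, Matrix.smul_apply, smul_eq_mul, steinDerivative, map_mul, map_neg, map_inv₀,
    Complex.conj_ofReal, map_natCast, conj_trace_mul_covarianceMatrix_mul]
  ring

/-- Summing the derivatives in Stein's identity over all entries reproduces `-m² φ`, up to terms
of lower order. -/
lemma sum_steinDerivative (hv : ‖v‖ = 1) {A : Matrix (Fin N) (Fin N) ℝ}
    (hA : A.IsHermitian) :
    (N : ℂ)⁻¹ * ((Real.sqrt N)⁻¹ : ℂ) * ∑ i, ∑ j, steinDerivative n v z i j A =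
      -(empiricalStieltjes A z ^ 2 +
          (N : ℂ)⁻¹ ^ 2 * divergenceError n v (resolventMatrix A z)) *
        conj (semicircleDefect (entryVariance n) z (empiricalStieltjes A z)) -
      (N : ℂ)⁻¹ ^ 3 * conj (2 * entryVariance n * empiricalStieltjes A z + z) *
        gradientError n v (resolventMatrix A z) := by
  have hG := transpose_resolventMatrix (z := z) hA
  have hGs : ((resolventMatrix A z)ᴴ)ᵀ = (resolventMatrix A z)ᴴ := by
    rw [← Matrix.conjTranspose_transpose_eq_transpose_conjTranspose, hG]
  have hH : ((resolventMatrix A z)ᴴ * (resolventMatrix A z)ᴴ)ᵀ =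
      (resolventMatrix A z)ᴴ * (resolventMatrix A z)ᴴ := by
    rw [Matrix.transpose_mul, hGs]
  have h1 := sum_mul_covarianceMatrix_mul (n := n) hv hG
  have h2 := sum_mul_trace_mul_covarianceMatrix (n := n) hv hG hH
  rw [← gradientError] at h2
  rw [← divergenceError] at h1
  have hsq : ((Real.sqrt N)⁻¹ : ℂ) * ((Real.sqrt N)⁻¹ : ℂ) = (N : ℂ)⁻¹ := by
    rw [← mul_inv, ← Complex.ofReal_mul, Real.mul_self_sqrt (Nat.cast_nonneg N)]
    simp
  have h3 : ∑ i, ∑ j, steinDerivative n v z i j A = -((Real.sqrt N)⁻¹ : ℂ) *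
      ((∑ i, ∑ j, (resolventMatrix A z * (covarianceMatrix n v i j).map Complex.ofReal *
          resolventMatrix A z) j i) *
        conj (semicircleDefect (entryVariance n) z (empiricalStieltjes A z)) +
      ((N : ℂ)⁻¹ * conj (2 * entryVariance n * empiricalStieltjes A z + z)) *
        ∑ i, ∑ j, resolventMatrix A z j i * ((resolventMatrix A z)ᴴ * (resolventMatrix A z)ᴴ *
            (covarianceMatrix n v i j).map Complex.ofReal).trace) := by
    simp only [steinDerivative, Finset.sum_mul, Finset.mul_sum, mul_add, Finset.sum_add_distrib]
    congr 1
    exact Finset.sum_congr rfl fun i _ => Finset.sum_congr rfl fun j _ => by ring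
  rw [h3, h1, h2]
  have h4 : (resolventMatrix A z).trace ^ 2 * (N : ℂ)⁻¹ ^ 2 = empiricalStieltjes A z ^ 2 := by
    rw [empiricalStieltjes]; ring
  rw [← h4]
  linear_combination (-(N : ℂ)⁻¹ * (((resolventMatrix A z).trace ^ 2 +
    divergenceError n v (resolventMatrix A z)) *
      conj (semicircleDefect (entryVariance n) z (empiricalStieltjes A z)) +
    (N : ℂ)⁻¹ * conj (2 * entryVariance n * empiricalStieltjes A z + z) *
      gradientError n v (resolventMatrix A z))) * hsq

end SelfConsistent

/-! ### The second moment of the defect -/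

section SecondMoment

open scoped Matrix Matrix.Norms.L2Operator ComplexConjugate

variable {n N : ℕ} {v : EuclideanSpace ℝ (Fin N)} {z : ℂ}

lemma one_div_gaussianTensorZ_nonneg (d N : ℕ) : 0 ≤ 1 / gaussianTensorZ d N :=
  one_div_nonneg.2 (integral_nonneg fun _ => (Real.exp_pos _).le)

lemma norm_steinDerivative_le_const (n : ℕ) (v : EuclideanSpace ℝ (Fin N)) (hz : z.im ≠ 0)
    (i j : Fin N) : ∃ C : ℝ, ∀ A : Matrix (Fin N) (Fin N) ℝ, A.IsHermitian →
      ‖steinDerivative n v z i j A‖ ≤ C := by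
  set c := 1 / |z.im| with hc
  have hc0 : 0 ≤ c := by positivity
  set R := (covarianceMatrix n v i j).map Complex.ofReal
  refine ⟨‖((Real.sqrt N)⁻¹ : ℂ)‖ * (c * ‖R‖ * c *
    (entryVariance n * c ^ 2 + ‖z‖ * c + 1) +
      c * (‖(N : ℂ)⁻¹‖ * (2 * entryVariance n * c + ‖z‖) * (N * (c * c * ‖R‖)))),
    fun A hA => ?_⟩
  have hs := entryVariance_pos n
  have hG : ‖resolventMatrix A z‖ ≤ c := norm_resolventMatrix_le hA hz
  have hGs : ‖(resolventMatrix A z)ᴴ‖ ≤ c := by rwa [Matrix.l2_opNorm_conjTranspose]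
  have hm : ‖empiricalStieltjes A z‖ ≤ c := norm_empiricalStieltjes_le hA hz
  have h1 : ‖(resolventMatrix A z * R * resolventMatrix A z) j i‖ ≤ c * ‖R‖ * c := by
    refine (norm_entry_le _ _ _).trans ((norm_mul_le _ _).trans ?_)
    gcongr
    exact (norm_mul_le _ _).trans (by gcongr)
  have h2 : ‖((resolventMatrix A z)ᴴ * (resolventMatrix A z)ᴴ * R).trace‖ ≤
      N * (c * c * ‖R‖) := by
    refine (norm_trace_le _).trans ?_
    gcongr
    refine (norm_mul_le _ _).trans ?_
    gcongr
    exact (norm_mul_le _ _).trans (by gcongr)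
  have h3 : ‖2 * (entryVariance n : ℂ) * empiricalStieltjes A z + z‖ ≤
      2 * entryVariance n * c + ‖z‖ := by
    refine (norm_add_le _ _).trans ?_
    rw [norm_mul, norm_mul, Complex.norm_ofNat, Complex.norm_real, Real.norm_of_nonneg hs.le]
    gcongr
  rw [steinDerivative, norm_mul, norm_neg]
  gcongr
  refine (norm_add_le _ _).trans ?_
  rw [norm_mul, norm_mul (resolventMatrix A z j i), norm_mul ((N : ℂ)⁻¹ * _), norm_mul (N : ℂ)⁻¹,
    RCLike.norm_conj, RCLike.norm_conj]
  gcongr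
  · exact norm_semicircleDefect_le hs.le hm
  · exact (norm_entry_le _ _ _).trans hG

lemma continuous_steinDerivative (hz : z.im ≠ 0) (i j : Fin N) :
    Continuous fun T : SymTensor (n + 2) N =>
      steinDerivative n v z i j (scaledContraction T v) := by
  have hG := continuous_resolventMatrix_scaledContraction (n := n) (v := v) hz
  have hm := continuous_empiricalStieltjes (n := n) (v := v) hz
  have hQ := (continuous_semicircleDefect (entryVariance n) z).comp hm
  unfold steinDerivative
  refine continuous_const.mul (Continuous.add ?_ ?_)
  · exact (((hG.matrix_mul continuous_const).matrix_mul hG).matrix_elem j i).mul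
      (Complex.continuous_conj.comp hQ)
  · refine (hG.matrix_elem j i).mul (Continuous.mul (continuous_const.mul
      (Complex.continuous_conj.comp ((continuous_const.mul hm).add continuous_const))) ?_)
    exact ((hG.matrix_conjTranspose.matrix_mul hG.matrix_conjTranspose).matrix_mul
      continuous_const).matrix_trace

/-- Pointwise bound for the error terms of the self-consistent equation. -/
lemma norm_error_le (hv : ‖v‖ = 1) (hN : N ≠ 0) {A : Matrix (Fin N) (Fin N) ℝ}
    (hA : A.IsHermitian) (hz : z.im ≠ 0) (q : ℂ) :
    ‖-(entryVariance n * (N : ℂ)⁻¹ ^ 2 * divergenceError n v (resolventMatrix A z)) * q -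
      entryVariance n * (N : ℂ)⁻¹ ^ 3 * conj (2 * entryVariance n * empiricalStieltjes A z + z) *
        gradientError n v (resolventMatrix A z)‖ ≤
      (1 / |z.im|) ^ 2 / N * ‖q‖ +
        (2 * (1 / |z.im|) + ‖z‖) * (1 / |z.im|) ^ 3 / (N : ℝ) ^ 2 := by
  set c := 1 / |z.im| with hc
  have hc0 : 0 ≤ c := by positivity
  have hN1 : (1 : ℝ) ≤ N := by exact_mod_cast Nat.one_le_iff_ne_zero.2 hN
  have hN0 : (0 : ℝ) < N := by linarith
  have hs := entryVariance_pos n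
  have hsn : entryVariance n * ((n + 2) * (n + 1)) = 1 := by
    rw [entryVariance]
    exact inv_mul_cancel₀ (by positivity)
  have hs1 : entryVariance n ≤ 1 := by
    rw [entryVariance]
    apply inv_le_one_of_one_le₀
    have : (0 : ℝ) ≤ n := Nat.cast_nonneg n
    nlinarith
  have hG : ‖resolventMatrix A z‖ ≤ c := norm_resolventMatrix_le hA hz
  have hm : ‖empiricalStieltjes A z‖ ≤ c := norm_empiricalStieltjes_le hA hz
  have hD := norm_divergenceError_le (n := n) hv hG
  have hE := norm_gradientError_le (n := n) hv hG
  have h3 : ‖2 * (entryVariance n : ℂ) * empiricalStieltjes A z + z‖ ≤ 2 * c + ‖z‖ := by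
    refine (norm_add_le _ _).trans ?_
    rw [norm_mul, norm_mul, Complex.norm_ofNat, Complex.norm_real, Real.norm_of_nonneg hs.le]
    have : 2 * entryVariance n * ‖empiricalStieltjes A z‖ ≤ 2 * 1 * c := by gcongr
    linarith
  have hn0 : (0 : ℝ) ≤ n := Nat.cast_nonneg n
  have hnn := natCast_mul_sub_one_nonneg n
  -- both counts of terms are at most `N (n + 2) (n + 1)`, which cancels the variance
  have hcount1 : entryVariance n * (N + 2 * n * (N + 1) + n * (n - 1)) ≤ N := by
    have : (N : ℝ) + 2 * n * (N + 1) + n * (n - 1) ≤ N * ((n + 2) * (n + 1)) := by nlinarith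
    calc _ ≤ entryVariance n * (N * ((n + 2) * (n + 1))) := by gcongr
      _ = N * (entryVariance n * ((n + 2) * (n + 1))) := by ring
      _ = N := by rw [hsn, mul_one]
  have hcount2 : entryVariance n * (2 * N + 4 * n + n * (n - 1)) ≤ N := by
    have : 2 * (N : ℝ) + 4 * n + n * (n - 1) ≤ N * ((n + 2) * (n + 1)) := by nlinarith
    calc _ ≤ entryVariance n * (N * ((n + 2) * (n + 1))) := by gcongr
      _ = N * (entryVariance n * ((n + 2) * (n + 1))) := by ring
      _ = N := by rw [hsn, mul_one]
  refine (norm_sub_le _ _).trans (add_le_add ?_ ?_)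
  · rw [norm_mul, norm_neg, norm_mul, norm_mul, norm_pow, norm_inv, Complex.norm_natCast,
      Complex.norm_real, Real.norm_of_nonneg hs.le]
    refine mul_le_mul_of_nonneg_right ?_ (norm_nonneg q)
    calc entryVariance n * (N : ℝ)⁻¹ ^ 2 * ‖divergenceError n v (resolventMatrix A z)‖
        ≤ entryVariance n * (N : ℝ)⁻¹ ^ 2 * ((N + 2 * n * (N + 1) + n * (n - 1)) * c ^ 2) := by
          gcongr
      _ = (N : ℝ)⁻¹ ^ 2 * c ^ 2 * (entryVariance n * (N + 2 * n * (N + 1) + n * (n - 1))) := by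
          ring
      _ ≤ (N : ℝ)⁻¹ ^ 2 * c ^ 2 * N := by gcongr
      _ = c ^ 2 / N := by field_simp
  · rw [norm_mul, norm_mul, norm_mul, norm_pow, norm_inv, Complex.norm_natCast, RCLike.norm_conj,
      Complex.norm_real, Real.norm_of_nonneg hs.le]
    calc _ ≤ entryVariance n * (N : ℝ)⁻¹ ^ 3 * (2 * c + ‖z‖) *
          ((2 * N + 4 * n + n * (n - 1)) * c ^ 3) := by gcongr
      _ = (N : ℝ)⁻¹ ^ 3 * ((2 * c + ‖z‖) * c ^ 3) *
          (entryVariance n * (2 * N + 4 * n + n * (n - 1))) := by ring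
      _ ≤ (N : ℝ)⁻¹ ^ 3 * ((2 * c + ‖z‖) * c ^ 3) * N := by gcongr
      _ = (2 * c + ‖z‖) * c ^ 3 / (N : ℝ) ^ 2 := by field_simp

/-- Absorption of the linear term: `E |Q|² = E err` with `|err| ≤ |Q|² / 2 + C` gives
`E |Q|² ≤ 2 C`. -/
lemma integral_norm_sq_le_of_integral_mul_conj_eq {X : Type*} [MeasurableSpace X] {μ : Measure X}
    [IsProbabilityMeasure μ] {Q err : X → ℂ} {C : ℝ} (hQ : Integrable (fun x => ‖Q x‖ ^ 2) μ)
    (h : ∫ x, Q x * conj (Q x) ∂μ = ∫ x, err x ∂μ)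
    (hle : ∀ x, ‖err x‖ ≤ 1 / 2 * ‖Q x‖ ^ 2 + C) : ∫ x, ‖Q x‖ ^ 2 ∂μ ≤ 2 * C := by
  have h1 : ∀ x, Q x * conj (Q x) = ((‖Q x‖ ^ 2 : ℝ) : ℂ) := by
    intro x
    rw [Complex.mul_conj, Complex.normSq_eq_norm_sq]
  have hnorm : ∫ x, ‖Q x‖ ^ 2 ∂μ = ‖∫ x, Q x * conj (Q x) ∂μ‖ := by
    simp only [h1]
    rw [integral_complex_ofReal, Complex.norm_real,
      Real.norm_of_nonneg (integral_nonneg fun x => by positivity)]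
  have hint : Integrable (fun x => 1 / 2 * ‖Q x‖ ^ 2 + C) μ :=
    (hQ.const_mul _).add (integrable_const _)
  have h2 : ‖∫ x, err x ∂μ‖ ≤ ∫ x, (1 / 2 * ‖Q x‖ ^ 2 + C) ∂μ :=
    norm_integral_le_of_norm_le hint (Eventually.of_forall hle)
  rw [integral_add (hQ.const_mul _) (integrable_const _), integral_const_mul] at h2
  simp only [integral_const, probReal_univ, one_smul] at h2
  rw [← h, ← hnorm] at h2
  linarith

/-- By Gaussian integration by parts, the defect of the empirical Stieltjes transform has second
moment `O(1 / N²)`. -/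
theorem integral_norm_semicircleDefect_sq_le [IsProbabilityMeasure (gaussianTensorLaw (n + 2) N)]
    (hv : ‖v‖ = 1) (hN : N ≠ 0) (hz : z.im ≠ 0) :
    ∫ T, ‖semicircleDefect (entryVariance n) z (empiricalStieltjes (scaledContraction T v) z)‖ ^ 2
      ∂(gaussianTensorLaw (n + 2) N) ≤
      ((1 / |z.im|) ^ 4 + 2 * ((2 * (1 / |z.im|) + ‖z‖) * (1 / |z.im|) ^ 3)) / (N : ℝ) ^ 2 := by
  set c := 1 / |z.im| with hc
  set γ := gaussianTensorLaw (n + 2) N with hγ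
  set s := entryVariance n with hsdef
  have hs : 0 < s := entryVariance_pos n
  set m : SymTensor (n + 2) N → ℂ := fun T => empiricalStieltjes (scaledContraction T v) z with hm
  set Q : SymTensor (n + 2) N → ℂ := fun T => semicircleDefect s z (m T) with hQ
  set G : SymTensor (n + 2) N → Matrix (Fin N) (Fin N) ℂ :=
    fun T => resolventMatrix (scaledContraction T v) z with hG
  have hherm : ∀ T : SymTensor (n + 2) N, (scaledContraction T v).IsHermitian := fun T =>
    isHermitian_scaledContraction T v
  have hcm : Continuous m := continuous_empiricalStieltjes hz
  have hcQ : Continuous Q := (continuous_semicircleDefect s z).comp hcm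
  have hcG : Continuous G := continuous_resolventMatrix_scaledContraction hz
  have hbm : ∀ T, ‖m T‖ ≤ c := fun T => norm_empiricalStieltjes_le (hherm T) hz
  have hbQ : ∀ T, ‖Q T‖ ≤ s * c ^ 2 + ‖z‖ * c + 1 := fun T =>
    norm_semicircleDefect_le hs.le (hbm T)
  have hbdd : ∀ {f : SymTensor (n + 2) N → ℂ}, Continuous f → ∀ C : ℝ, (∀ T, ‖f T‖ ≤ C) →
      Integrable f γ := fun hf C hC =>
    Integrable.of_bound hf.aestronglyMeasurable C (Eventually.of_forall hC)
  -- the functions to which Stein's identity is applied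
  set F : Fin N → Fin N → SymTensor (n + 2) N → ℂ := fun i j T => G T j i * conj (Q T) with hF
  set S : Fin N → Fin N → SymTensor (n + 2) N := fun i j =>
    slotTensor v (Pi.single i 1) (Pi.single j 1) with hS
  have hcF : ∀ i j, Continuous (F i j) := fun i j =>
    (hcG.matrix_elem j i).mul (Complex.continuous_conj.comp hcQ)
  have hbF : ∀ i j T, ‖F i j T‖ ≤ c * (s * c ^ 2 + ‖z‖ * c + 1) := by
    intro i j T
    rw [norm_mul, RCLike.norm_conj]
    have h1 : ‖G T j i‖ ≤ c := (norm_entry_le _ _ _).trans (norm_resolventMatrix_le (hherm T) hz)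
    exact mul_le_mul h1 (hbQ T) (norm_nonneg _) ((norm_nonneg _).trans h1)
  set D : Fin N → Fin N → SymTensor (n + 2) N → ℂ := fun i j T =>
    steinDerivative n v z i j (scaledContraction T v) with hD
  have hcD : ∀ i j, Continuous (D i j) := fun i j => continuous_steinDerivative hz i j
  have hstein : ∀ i j, ∫ T, (inner ℝ T (S i j) : ℂ) * F i j T ∂γ = ∫ T, D i j T ∂γ := by
    intro i j
    obtain ⟨C, hC⟩ := norm_steinDerivative_le_const n v hz i j
    exact integral_inner_mul_eq_integral_lineDeriv (one_div_gaussianTensorZ_nonneg (n + 2) N)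
      (hcF i j) (hcD i j) (hbF i j) (fun T => hC _ (hherm T))
      (fun T => hasLineDerivAt_stein hz T i j)
  have hintF : ∀ i j, Integrable (fun T => (inner ℝ T (S i j) : ℂ) * F i j T) γ := by
    intro i j
    refine integrable_withDensity_exp_neg_norm_sq (one_div_gaussianTensorZ_nonneg (n + 2) N) ?_
    refine (integrable_bounded_mul (hcF i j) (hbF i j) (integrable_inner_mul_exp (S i j))).congr
      (Eventually.of_forall fun T => ?_)
    simp only []
    push_cast
    ring
  have hintD : ∀ i j, Integrable (D i j) γ := by
    intro i j
    obtain ⟨C, hC⟩ := norm_steinDerivative_le_const n v hz i j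
    exact hbdd (hcD i j) C fun T => hC _ (hherm T)
  set κ : ℂ := (N : ℂ)⁻¹ * ((Real.sqrt N)⁻¹ : ℂ) * s with hκ
  have hmain : ∀ T, Q T * conj (Q T) = s * m T ^ 2 * conj (Q T) +
      ∑ i, ∑ j, κ * ((inner ℝ T (S i j) : ℂ) * F i j T) := by
    intro T
    have h1 := semicircleDefect_mul_eq hN s hz (hherm T)
    have h2 : ∀ i j, (scaledContraction T v i j : ℂ) =
        ((Real.sqrt N)⁻¹ : ℂ) * s * (inner ℝ T (S i j) : ℂ) := by
      intro i j
      rw [hS, inner_slotTensor_single, hsdef, entryVariance]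
      have : (n : ℂ) + 2 ≠ 0 := by exact_mod_cast (by positivity : (n : ℝ) + 2 ≠ 0)
      have : (n : ℂ) + 1 ≠ 0 := by exact_mod_cast (by positivity : (n : ℝ) + 1 ≠ 0)
      simp only [scaledContraction, Matrix.smul_apply, smul_eq_mul]
      push_cast
      field_simp
    calc Q T * conj (Q T) = (s * m T ^ 2 + (N : ℂ)⁻¹ * ∑ i, ∑ j,
          (scaledContraction T v i j : ℂ) * G T j i) * conj (Q T) := by
          conv_lhs => rw [hQ]
          exact congrArg (· * conj (Q T)) h1
      _ = _ := by
          rw [add_mul, Finset.mul_sum, Finset.sum_mul]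
          congr 1
          refine Finset.sum_congr rfl fun i _ => ?_
          rw [Finset.mul_sum, Finset.sum_mul]
          refine Finset.sum_congr rfl fun j _ => ?_
          rw [h2 i j, hF, hκ]
          ring
  have hint0 : Integrable (fun T => s * m T ^ 2 * conj (Q T)) γ := by
    refine hbdd ((continuous_const.mul (hcm.pow 2)).mul (Complex.continuous_conj.comp hcQ))
      (s * c ^ 2 * (s * c ^ 2 + ‖z‖ * c + 1)) fun T => ?_
    rw [norm_mul, norm_mul, norm_pow, RCLike.norm_conj, Complex.norm_real,
      Real.norm_of_nonneg hs.le]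
    exact mul_le_mul (by gcongr; exact hbm T) (hbQ T) (norm_nonneg _) (by positivity)
  set err : SymTensor (n + 2) N → ℂ := fun T =>
    -(s * (N : ℂ)⁻¹ ^ 2 * divergenceError n v (G T)) * conj (Q T) -
      s * (N : ℂ)⁻¹ ^ 3 * conj (2 * s * m T + z) * gradientError n v (G T) with herr
  have herreq : ∀ T, s * m T ^ 2 * conj (Q T) + ∑ i, ∑ j, κ * D i j T = err T := by
    intro T
    have h1 := sum_steinDerivative (n := n) (z := z) hv (hherm T)
    have h2 : ∑ i, ∑ j, κ * D i j T =
        s * ((N : ℂ)⁻¹ * ((Real.sqrt N)⁻¹ : ℂ) * ∑ i, ∑ j, D i j T) := by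
      simp only [Finset.mul_sum, hκ]
      exact Finset.sum_congr rfl fun i _ => Finset.sum_congr rfl fun j _ => by ring
    rw [h2, hD, h1, herr]
    simp only [hQ, hm, hG]
    ring
  have hintegral : ∫ T, Q T * conj (Q T) ∂γ = ∫ T, err T ∂γ := by
    have e1 : ∫ T, ∑ i, ∑ j, κ * ((inner ℝ T (S i j) : ℂ) * F i j T) ∂γ =
        ∫ T, ∑ i, ∑ j, κ * D i j T ∂γ := by
      rw [integral_finsetSum _ fun i _ => integrable_finsetSum _ fun j _ => (hintF i j).const_mul κ,
        integral_finsetSum _ fun i _ => integrable_finsetSum _ fun j _ => (hintD i j).const_mul κ]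
      refine Finset.sum_congr rfl fun i _ => ?_
      rw [integral_finsetSum _ fun j _ => (hintF i j).const_mul κ,
        integral_finsetSum _ fun j _ => (hintD i j).const_mul κ]
      refine Finset.sum_congr rfl fun j _ => ?_
      rw [integral_const_mul, integral_const_mul, hstein i j]
    simp only [hmain, ← herreq]
    rw [integral_add hint0 (integrable_finsetSum _ fun i _ => integrable_finsetSum _ fun j _ =>
        (hintF i j).const_mul κ),
      integral_add hint0 (integrable_finsetSum _ fun i _ => integrable_finsetSum _ fun j _ =>
        (hintD i j).const_mul κ), e1]
  have hQsq : Integrable (fun T => ‖Q T‖ ^ 2) γ := by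
    refine Integrable.of_bound (hcQ.norm.pow 2).aestronglyMeasurable
      ((s * c ^ 2 + ‖z‖ * c + 1) ^ 2) (Eventually.of_forall fun T => ?_)
    rw [norm_pow, norm_norm]
    have := hbQ T
    gcongr
  have hle : ∀ T, ‖err T‖ ≤ 1 / 2 * ‖Q T‖ ^ 2 +
      (c ^ 4 / 2 + (2 * c + ‖z‖) * c ^ 3) / (N : ℝ) ^ 2 := by
    intro T
    have h1 := norm_error_le (n := n) hv hN (hherm T) hz (conj (Q T))
    rw [RCLike.norm_conj] at h1
    refine h1.trans ?_
    have h2 : c ^ 2 / N * ‖Q T‖ ≤ 1 / 2 * ‖Q T‖ ^ 2 + c ^ 4 / 2 / (N : ℝ) ^ 2 := by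
      have h3 : c ^ 4 / 2 / (N : ℝ) ^ 2 = 1 / 2 * (c ^ 2 / N) ^ 2 := by ring
      rw [h3]
      nlinarith [sq_nonneg (‖Q T‖ - c ^ 2 / N)]
    rw [add_div]
    linarith
  have hsplit : (c ^ 4 + 2 * ((2 * c + ‖z‖) * c ^ 3)) / (N : ℝ) ^ 2 =
      2 * ((c ^ 4 / 2 + (2 * c + ‖z‖) * c ^ 3) / (N : ℝ) ^ 2) := by ring
  rw [hsplit]
  exact integral_norm_sq_le_of_integral_mul_conj_eq hQsq hintegral hle

end SecondMoment

/-! ### Almost sure convergence of the spectral measures -/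

lemma isProbabilityMeasure_empiricalSpectralMeasure {N : ℕ} (hN : N ≠ 0)
    {A : Matrix (Fin N) (Fin N) ℝ} (hA : A.IsHermitian) :
    IsProbabilityMeasure (empiricalSpectralMeasure hA) := by
  refine ⟨?_⟩
  rw [empiricalSpectralMeasure, Measure.smul_apply, Measure.finsetSum_apply]
  simp only [measure_univ, Finset.sum_const, Finset.card_univ, Fintype.card_fin, nsmul_eq_mul,
    mul_one, smul_eq_mul]
  exact ENNReal.inv_mul_cancel (by exact_mod_cast hN) (ENNReal.natCast_ne_top N)

lemma integral_empiricalSpectralMeasure {N : ℕ} {A : Matrix (Fin N) (Fin N) ℝ}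
    (hA : A.IsHermitian) {z : ℂ} (hz : z.im ≠ 0) :
    ∫ x : ℝ, 1 / ((x : ℂ) - z) ∂(empiricalSpectralMeasure hA) = empiricalStieltjes A z := by
  rw [empiricalSpectralMeasure, integral_smul_measure, integral_finsetSum_measure,
    empiricalStieltjes,
    trace_resolventMatrix hA hz]
  · simp only [integral_dirac]
    rw [Complex.real_smul]
    simp
  · intro i _
    exact integrable_dirac (by simp)

lemma empiricalStieltjes_im_nonneg {N : ℕ} {A : Matrix (Fin N) (Fin N) ℝ} (hA : A.IsHermitian)
    {z : ℂ} (hz : 0 < z.im) : 0 ≤ (empiricalStieltjes A z).im := by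
  have h : (N : ℂ)⁻¹ = (((N : ℝ)⁻¹ : ℝ) : ℂ) := by push_cast; rfl
  rw [empiricalStieltjes, trace_resolventMatrix hA hz.ne', h, Complex.im_ofReal_mul, Complex.im_sum]
  refine mul_nonneg (by positivity) (Finset.sum_nonneg fun i _ => ?_)
  rw [im_one_div_ofReal_sub]
  exact div_nonneg hz.le (Complex.normSq_nonneg _)

/-- In the closed upper half-plane the quadratic equation has a single root, and it is stable: the
second root has imaginary part at most `- Im z / s`. -/
lemma norm_sub_mul_im_le_norm_semicircleDefect {s : ℝ} (hs : 0 < s) {z m m₀ : ℂ}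
    (hm : 0 ≤ m.im) (hm₀ : 0 ≤ m₀.im) (h₀ : semicircleDefect s z m₀ = 0) :
    ‖m - m₀‖ * z.im ≤ ‖semicircleDefect s z m‖ := by
  have h1 : semicircleDefect s z m = (m - m₀) * (s * (m + m₀) + z) := by
    rw [← sub_zero (semicircleDefect s z m), ← h₀]
    unfold semicircleDefect
    ring
  have h2 : z.im ≤ ‖(s : ℂ) * (m + m₀) + z‖ := by
    refine le_trans ?_ ((le_abs_self _).trans (Complex.abs_im_le_norm _))
    rw [Complex.add_im, Complex.im_ofReal_mul, Complex.add_im]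
    nlinarith
  rw [h1, norm_mul]
  gcongr

lemma semicircleDefect_stieltjesM (n : ℕ) {z : ℂ} (hz : 0 < z.im) :
    semicircleDefect (entryVariance n) z (stieltjesM (n + 2) z) = 0 := by
  have h := stieltjesM_quadratic (d := n + 2) (by omega)
    (notMem_image_ofReal_of_im_pos hz (Set.Icc (-betaEdge (n + 2)) (betaEdge (n + 2))))
  have hs : (entryVariance n : ℂ) = (betaEdge (n + 2) : ℂ) ^ 2 / 4 := by
    rw [← Complex.ofReal_pow, betaEdge_sq (by omega), entryVariance]
    push_cast
    rw [show (n : ℂ) + 2 - 1 = n + 1 by ring]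
    ring
  rw [semicircleDefect, hs]
  exact h

/-- Random variables with summable second moments converge to zero almost surely. -/
lemma ae_tendsto_zero_of_integral_norm_sq_le {Ω : Type*} [MeasurableSpace Ω] {P : Measure Ω}
    {Y : ℕ → Ω → ℂ} (hY : ∀ n, AEMeasurable (Y n) P)
    (hint : ∀ n, Integrable (fun ω => ‖Y n ω‖ ^ 2) P) {b : ℕ → ℝ} (hb : Summable b)
    (hle : ∀ n, ∫ ω, ‖Y n ω‖ ^ 2 ∂P ≤ b n) :
    ∀ᵐ ω ∂P, Tendsto (fun n => Y n ω) atTop (𝓝 0) := by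
  have hb0 : ∀ n, 0 ≤ b n := fun n => (integral_nonneg fun ω => by positivity).trans (hle n)
  have hmeas : ∀ n, AEMeasurable (fun ω => ENNReal.ofReal (‖Y n ω‖ ^ 2)) P := fun n =>
    ((hY n).norm.pow_const 2).ennreal_ofReal
  have hsum : ∫⁻ ω, ∑' n, ENNReal.ofReal (‖Y n ω‖ ^ 2) ∂P ≠ ∞ := by
    rw [lintegral_tsum hmeas]
    refine ne_top_of_le_ne_top (hb.tsum_ofReal_ne_top) (ENNReal.tsum_le_tsum fun n => ?_)
    rw [← ofReal_integral_eq_lintegral_ofReal (hint n)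
      (Eventually.of_forall fun ω => by positivity)]
    exact ENNReal.ofReal_le_ofReal (hle n)
  filter_upwards [ae_lt_top' (AEMeasurable.tsum hmeas) hsum] with ω hω
  have h1 := ENNReal.tendsto_atTop_zero_of_tsum_ne_top hω.ne
  have h2 := (ENNReal.tendsto_toReal ENNReal.zero_ne_top).comp h1
  simp only [ENNReal.toReal_zero, Function.comp_def] at h2
  rw [tendsto_zero_iff_norm_tendsto_zero]
  have h3 := h2.sqrt
  rw [Real.sqrt_zero] at h3
  refine h3.congr fun n => ?_
  rw [ENNReal.toReal_ofReal (by positivity), Real.sqrt_sq (norm_nonneg _)]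

lemma ae_tendsto_semicircleDefect {Ω : Type*} [MeasurableSpace Ω] {P : Measure Ω}
    [IsProbabilityMeasure P] {n : ℕ} {W : (N : ℕ) → Ω → SymTensor (n + 2) N}
    (hW : ∀ N : ℕ, 1 ≤ N → HasLaw (W N) (gaussianTensorLaw (n + 2) N) P)
    {v : (N : ℕ) → EuclideanSpace ℝ (Fin N)} (hv : ∀ N : ℕ, 1 ≤ N → ‖v N‖ = 1) {z : ℂ}
    (hz : z.im ≠ 0) :
    ∀ᵐ ω ∂P, Tendsto (fun N => semicircleDefect (entryVariance n) z
      (empiricalStieltjes (scaledContraction (W (N + 1) ω) (v (N + 1))) z)) atTop (𝓝 0) := by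
  have hc : ∀ N, Continuous fun T : SymTensor (n + 2) (N + 1) =>
      semicircleDefect (entryVariance n) z
        (empiricalStieltjes (scaledContraction T (v (N + 1))) z) :=
    fun N => (continuous_semicircleDefect _ z).comp (continuous_empiricalStieltjes hz)
  set K := (1 / |z.im|) ^ 4 + 2 * ((2 * (1 / |z.im|) + ‖z‖) * (1 / |z.im|) ^ 3) with hK
  have hlaw : ∀ N, HasLaw (W (N + 1)) (gaussianTensorLaw (n + 2) (N + 1)) P := fun N =>
    hW (N + 1) (by omega)
  have hmeas : ∀ N, AEMeasurable (fun ω => semicircleDefect (entryVariance n) z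
      (empiricalStieltjes (scaledContraction (W (N + 1) ω) (v (N + 1))) z)) P := fun N =>
    (hc N).measurable.comp_aemeasurable (hlaw N).aemeasurable
  refine ae_tendsto_zero_of_integral_norm_sq_le (b := fun N : ℕ => K / ((N + 1 : ℕ) : ℝ) ^ 2)
    hmeas (fun N => ?_) ?_ fun N => ?_
  · refine Integrable.of_bound ((hmeas N).norm.pow_const 2).aestronglyMeasurable
      ((entryVariance n * (1 / |z.im|) ^ 2 + ‖z‖ * (1 / |z.im|) + 1) ^ 2)
      (Eventually.of_forall fun ω => ?_)
    rw [norm_pow, norm_norm]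
    have := norm_semicircleDefect_le (z := z) (entryVariance_pos n).le
      (norm_empiricalStieltjes_le (isHermitian_scaledContraction (W (N + 1) ω) (v (N + 1))) hz)
    gcongr
  · have h : Summable fun N : ℕ => 1 / ((N + 1 : ℕ) : ℝ) ^ 2 :=
      (summable_nat_add_iff 1).2 (Real.summable_one_div_nat_pow.2 one_lt_two)
    refine (h.mul_left K).congr fun N => ?_
    rw [mul_one_div]
  · have hprob : IsProbabilityMeasure (gaussianTensorLaw (n + 2) (N + 1)) := by
      rw [← (hlaw N).map_eq]
      exact Measure.isProbabilityMeasure_map (hlaw N).aemeasurable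
    have h1 := (hlaw N).integral_comp (f := fun T => ‖semicircleDefect (entryVariance n) z
      (empiricalStieltjes (scaledContraction T (v (N + 1))) z)‖ ^ 2)
      ((hc N).norm.pow 2).aestronglyMeasurable
    exact h1.le.trans (integral_norm_semicircleDefect_sq_le (hv (N + 1) (by omega)) (by omega) hz)

lemma ae_convergesWeakly {Ω : Type*} [MeasurableSpace Ω] {P : Measure Ω}
    [IsProbabilityMeasure P] {n : ℕ} {W : (N : ℕ) → Ω → SymTensor (n + 2) N}
    (hW : ∀ N : ℕ, 1 ≤ N → HasLaw (W N) (gaussianTensorLaw (n + 2) N) P)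
    {v : (N : ℕ) → EuclideanSpace ℝ (Fin N)} (hv : ∀ N : ℕ, 1 ≤ N → ‖v N‖ = 1) :
    ∀ᵐ ω ∂P, ConvergesWeakly
      (fun N => empiricalSpectralMeasure (isHermitian_scaledContraction (W N ω) (v N)))
      (semicircleLaw (betaEdge (n + 2))) := by
  obtain ⟨D, hDc, hD⟩ := TopologicalSpace.exists_countable_dense ℂ
  have hall : ∀ᵐ ω ∂P, ∀ z ∈ D, 0 < z.im → Tendsto (fun N => semicircleDefect (entryVariance n) z
      (empiricalStieltjes (scaledContraction (W (N + 1) ω) (v (N + 1))) z)) atTop (𝓝 0) := by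
    rw [ae_ball_iff hDc]
    intro z _
    by_cases hz : 0 < z.im
    · filter_upwards [ae_tendsto_semicircleDefect hW hv hz.ne'] with ω hω _ using hω
    · exact Eventually.of_forall fun ω h => absurd h hz
  have hβ := betaEdge_pos (d := n + 2) (by omega)
  have hprob := isProbabilityMeasure_semicircleLaw hβ
  filter_upwards [hall] with ω hω f
  rw [← tendsto_add_atTop_iff_nat 1]
  have hprob2 : ∀ N, IsProbabilityMeasure (empiricalSpectralMeasure
      (isHermitian_scaledContraction (W (N + 1) ω) (v (N + 1)))) := fun N =>
    isProbabilityMeasure_empiricalSpectralMeasure (by omega) _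
  refine tendsto_integral_of_tendsto_stieltjes (μ := fun N => empiricalSpectralMeasure
    (isHermitian_scaledContraction (W (N + 1) ω) (v (N + 1)))) hD (fun z hzD hz => ?_) f
  simp only [integral_empiricalSpectralMeasure _ hz.ne']
  rw [integral_one_div_sub_eq_stieltjesM (by omega) (notMem_image_ofReal_of_im_pos hz _),
    tendsto_iff_norm_sub_tendsto_zero]
  have h1 := ((hω z hzD hz).norm).div_const z.im
  rw [norm_zero, zero_div] at h1
  refine squeeze_zero (fun N => norm_nonneg _) (fun N => ?_) h1
  rw [le_div_iff₀ hz]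
  exact norm_sub_mul_im_le_norm_semicircleDefect (entryVariance_pos n)
    (empiricalStieltjes_im_nonneg (isHermitian_scaledContraction _ _) hz)
    (stieltjesM_im_nonneg (by omega) hz) (semicircleDefect_stieltjesM n hz)

theorem theorem1 {Ω : Type*} [MeasurableSpace Ω] (P : Measure Ω) [IsProbabilityMeasure P]
    (d : ℕ) (hd : 3 ≤ d)
    (W : (N : ℕ) → Ω → SymTensor d N)
    (hW : ∀ N : ℕ, 1 ≤ N → HasLaw (W N) (gaussianTensorLaw d N) P)
    (v : (N : ℕ) → EuclideanSpace ℝ (Fin N))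
    (hv : ∀ N : ℕ, 1 ≤ N → ‖v N‖ = 1) :
    (∀ᵐ ω ∂P, ConvergesWeakly
      (fun N => empiricalSpectralMeasure
        (scaledContraction_isHermitian (by omega : 2 ≤ d) (W N ω) (v N)))
      (semicircleLaw (betaEdge d))) ∧
    IsProbabilityMeasure (semicircleLaw (betaEdge d)) ∧
    (semicircleLaw (betaEdge d)).support = Set.Icc (-betaEdge d) (betaEdge d) ∧
    (∀ z : ℂ, z ∉ (fun x : ℝ => (x : ℂ)) '' Set.Icc (-betaEdge d) (betaEdge d) →
      Integrable (fun t : ℝ => 1 / ((t : ℂ) - z)) (semicircleLaw (betaEdge d)) ∧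
      ∫ t : ℝ, 1 / ((t : ℂ) - z) ∂(semicircleLaw (betaEdge d)) = stieltjesM d z) := by
  obtain ⟨n, rfl⟩ : ∃ n, d = n + 2 := ⟨d - 2, by omega⟩
  have hβ := betaEdge_pos (d := n + 2) (by omega)
  refine ⟨ae_convergesWeakly hW hv, isProbabilityMeasure_semicircleLaw hβ,
    support_semicircleLaw hβ, fun z hz => ⟨?_, ?_⟩⟩
  · exact integrable_semicircleLaw hβ (continuousOn_one_div_sub hz)
  · exact integral_one_div_sub_eq_stieltjesM (by omega) hz
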